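/- Let $k$ be a field and let $R$ be a finite-dimensional $k$-algebra. Write $\mathrm{Mod}\text{-}A$ for the category of all right modules over a $k$-algebra $A$, $\mathrm{mod}\text{-}A$ for that of the finitely presented ones and $\mathrm{fin}\text{-}A$ for that of the finite-dimensional ones; all functors are $k$-linear. Assume that $R$ is *finitely controlled wild*: there are a faithful exact functor $F:\mathrm{fin}\text{-}k\langle X,Y\rangle\to\mathrm{mod}\text{-}R$ and a module $C\in\mathrm{mod}\text{-}R$ such that, for all $M,N\in\mathrm{fin}\text{-}k\langle X,Y\rangle$, $$\mathrm{Hom}_R(FM,FN)=F\,\mathrm{Hom}(M,N)\oplus\mathrm{Hom}_R(FM,FN)_{\mathrm{add}(C)}\quad\text{and}\quad \mathrm{Hom}_R(FM,FN)_{\mathrm{add}(C)}\subseteq\mathrm{rad}\,\mathrm{Hom}_R(FM,FN),$$ where $\mathrm{add}(C)$ consists of the direct summands of finite direct sums of copies of $C$, $\mathrm{Hom}_R(-,-)_{\mathrm{add}(C)}$ denotes the set of the morphisms that factor through a module in $\mathrm{add}(C)$, and $\mathrm{rad}$ is the radical of the category $\mathrm{mod}\text{-}R$. Then for every finitely generated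 $k$-algebra $S$ (for instance $S=k\langle X,Y\rangle$) there are a definable subcategory $\mathcal D$ of $\mathrm{Mod}\text{-}R$, that is, a full subcategory closed under isomorphisms, direct products, direct limits and pure submodules, and an interpretation functor $I:\mathcal D\to\mathrm{Mod}\text{-}S$, that is, an additive $k$-linear functor that commutes with direct products and direct limits, whose image is all of $\mathrm{Mod}\text{-}S$: every right $S$-module is isomorphic to $I(M)$ for some $M\in\mathcal D$. -/

import Mathlib

open CategoryTheory CategoryTheory.Limits

universe u

/-! ### Module categories -/

/-- The category of all right `A`-modules, as modules over the opposite ring.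
For an algebra `A` over a field `k` it is `k`-linear (instance `ModuleCat.linearOverField`). -/
abbrev RightMod (A : Type u) [Ring A] : Type (u + 1) := ModuleCat.{u} Aᵐᵒᵖ

/-- The right `A`-modules that are finite-dimensional over `k`, where `k` acts through the
structure map of the `k`-algebra `A`. -/
def finDimModules (k A : Type u) [Field k] [Ring A] [Algebra k A] : ObjectProperty (RightMod A) :=
  fun M => @Module.Finite k M _ _ (ModuleCat.moduleOfAlgebraModule M)

/-- The category of finite-dimensional right `A`-modules. -/
abbrev FinMod (k A : Type u) [Field k] [Ring A] [Algebra k A] : Type (u + 1) :=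
  (finDimModules k A).FullSubcategory

/-- The finitely presented right `A`-modules. -/
def finPresModules (A : Type u) [Ring A] : ObjectProperty (RightMod A) :=
  fun M => Module.FinitePresentation Aᵐᵒᵖ M

/-- The category of finitely presented right `A`-modules. -/
abbrev FpMod (A : Type u) [Ring A] : Type (u + 1) := (finPresModules A).FullSubcategory

/-! ### Controlled representation embeddings -/

/-- `add(C)`: the finitely presented modules that are direct summands of a finite direct sum of
copies of `C`. It is closed under isomorphisms, finite direct sums and direct summands. -/
def addClosure {A : Type u} [Ring A] (C : FpMod A) : ObjectProperty (FpMod A) :=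
  fun X => ∃ n : ℕ, Nonempty (Retract X.obj (ModuleCat.of Aᵐᵒᵖ (Fin n → C.obj)))

/-- A morphism factors through some object with property `P`. -/
def FactorsThroughProperty {𝒜 : Type*} [Category 𝒜] (P : ObjectProperty 𝒜) {X Y : 𝒜}
    (f : X ⟶ Y) : Prop :=
  ∃ (Z : 𝒜) (_ : P Z) (g : X ⟶ Z) (h : Z ⟶ Y), f = g ≫ h

/-- The (Jacobson) radical of a preadditive category: `f : X ⟶ Y` lies in `rad(X, Y)` iff
`1 - g f` is invertible in `End X` for every `g : Y ⟶ X`. -/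
def InRadical {𝒜 : Type*} [Category 𝒜] [Preadditive 𝒜] {X Y : 𝒜} (f : X ⟶ Y) : Prop :=
  ∀ g : Y ⟶ X, IsIso (𝟙 X - f ≫ g)

/-- `F : fin-S ⥤ mod-R` is a finitely controlled representation embedding: a faithful exact
(`k`-linear) functor such that, for some finitely presented `C` and all `M`, `N`, the space
`Hom(FM, FN)` is the direct sum of `F Hom(M, N)` and of the subspace of the morphisms that factor
through `add(C)`, and the latter lies in the radical. -/
structure IsFinitelyControlledEmbedding (k : Type u) {S R : Type u} [Field k] [Ring S] [Algebra k S]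
    [Ring R] [Algebra k R] (F : FinMod k S ⥤ FpMod R) : Prop where
  additive : F.Additive
  linear : F.Linear k
  faithful : F.Faithful
  leftExact : PreservesFiniteLimits F
  rightExact : PreservesFiniteColimits F
  controlled : ∃ C : FpMod R, ∀ M N : FinMod k S,
    -- the sum of the two subspaces is everything
    (∀ f : F.obj M ⟶ F.obj N, ∃ (g : M ⟶ N) (h : F.obj M ⟶ F.obj N),
      FactorsThroughProperty (addClosure C) h ∧ f = F.map g + h) ∧
    -- their intersection is zero
    (∀ g : M ⟶ N, FactorsThroughProperty (addClosure C) (F.map g) → F.map g = 0) ∧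
    -- the second one lies in the radical
    (∀ h : F.obj M ⟶ F.obj N, FactorsThroughProperty (addClosure C) h → InRadical h)

/-- The `k`-algebra `R` is finitely controlled wild: there is a finitely controlled representation
embedding `fin-k⟨X,Y⟩ ⥤ mod-R`. -/
def IsFinitelyControlledWild (k R : Type u) [Field k] [Ring R] [Algebra k R] : Prop :=
  ∃ F : FinMod k (FreeAlgebra k (Fin 2)) ⥤ FpMod R, IsFinitelyControlledEmbedding k F

/-! ### Definable subcategories and interpretation functors -/

/-- A submodule `N` of `M` is pure: every finite system of linear equations with constants in `N`
that is solvable in `M` is solvable in `N`. -/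
def IsPureSubmodule {A M : Type*} [Ring A] [AddCommGroup M] [Module A M] (N : Submodule A M) :
    Prop :=
  ∀ (p q : ℕ) (a : Fin q → Fin p → A) (b : Fin q → N),
    (∃ x : Fin p → M, ∀ j, ∑ i, a j i • x i = (b j : M)) →
      ∃ x : Fin p → N, ∀ j, ∑ i, a j i • x i = b j

/-- A full subcategory of `Mod-A` is definable: it is closed under isomorphisms, direct products,
direct limits (filtered colimits) and pure submodules. -/
structure IsDefinableSubcategory {A : Type u} [Ring A] (D : ObjectProperty (RightMod A)) :
    Prop where
  closedUnderIso : D.IsClosedUnderIsomorphisms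
  closedUnderProducts : ∀ J : Type u, D.IsClosedUnderLimitsOfShape (Discrete J)
  closedUnderDirectLimits : ∀ (J : Type u) [SmallCategory J] [IsFiltered J],
    D.IsClosedUnderColimitsOfShape J
  closedUnderPure : ∀ (M : RightMod A) (N : Submodule Aᵐᵒᵖ M), IsPureSubmodule N → D M →
    D (ModuleCat.of Aᵐᵒᵖ N)

/-- A functor from a (definable) full subcategory of `Mod-R` to `Mod-S` is an interpretation
functor: it is additive, `k`-linear, and commutes with direct products and with direct limits. -/
structure IsInterpretationFunctor (k : Type u) {R S : Type u} [Field k] [Ring R] [Algebra k R]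
    [Ring S] [Algebra k S] {D : ObjectProperty (RightMod R)}
    (I : D.FullSubcategory ⥤ RightMod S) : Prop where
  additive : I.Additive
  linear : I.Linear k
  preservesProducts : ∀ J : Type u, PreservesLimitsOfShape (Discrete J) I
  preservesDirectLimits : PreservesFilteredColimits I

/-! Let `ι` index algebra generators of `S` and consider the quiver with two vertices and parallel
arrows indexed by `Option ι`. Its finite-dimensional representations embed fully faithfully into
those of `k⟨X,Y⟩`: arrows become operators on `U × W`, and several operators are encoded by two
shifts (`eq_diagonal_of_commute_shifts`). Let `Q₁` and `Q₂` be the images of the projectives `0 → k`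
and `k → k ^ Option ι`. Then `Hom(Q₂, Z)` and `Hom(Q₁, Z)` are the source and target spaces of a
representation `Z`, and precomposition with the canonical maps `Q₁ ⟶ Q₂` gives its arrows.

Take a left `add(C)`-approximation `gᵢ` of `F Qᵢ`, and let `Vᵢ` be `Hom(F Qᵢ, -)` modulo the maps
factoring through `gᵢ`. As the modules involved are finitely presented, `Vᵢ` is defined on all
`R`-modules and commutes with products and filtered colimits, while control of `F` gives `Vᵢ(F Z) ≅
Hom(Qᵢ, Z)` (`controlledEquiv`). The arrows induce transformations `τ : V₂ ⟶ V₁`. The category `D`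
consists of the modules on which `τ none` is invertible and the operators `τ none ⁻¹ ∘ τ i` satisfy
the relations of `S`; the functor is `V₂` with this action.

For essential surjectivity, view an `S`-module `N` as the representation `N ⇉ N` with `none` acting
as the identity and `i` as the generator. It is usually infinite-dimensional, hence outside the
domain of `F`, but it is the directed union of its finite-dimensional subrepresentations. The
colimit `M` of their images under `F`, formed among all `R`-modules, satisfies `V₂ M ≅ N ≅ V₁ M`
compatibly with the arrows (`exists_obj_with_operators`). -/

/-! ### Quotients of Hom functors -/

section HomQuotient

variable {k : Type u} [Field k] {C : Type (u + 1)} [Category.{u} C] [Preadditive C] [Linear k C]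

variable (k) in
/-- The morphisms `B ⟶ M` that factor through `g : B ⟶ L`. -/
def factorSubmodule {B L : C} (g : B ⟶ L) (M : C) : Submodule k (B ⟶ M) :=
  LinearMap.range (Linear.leftComp k M g)

lemma mem_factorSubmodule {B L M : C} {g : B ⟶ L} {f : B ⟶ M} :
    f ∈ factorSubmodule k g M ↔ ∃ h : L ⟶ M, g ≫ h = f := Iff.rfl

variable (k) in
/-- The functor `Hom(B, -)` modulo the morphisms that factor through `g : B ⟶ L`. -/
def homQuotient {B L : C} (g : B ⟶ L) : C ⥤ ModuleCat.{u} k where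
  obj M := ModuleCat.of k ((B ⟶ M) ⧸ factorSubmodule k g M)
  map {M N} f := ModuleCat.ofHom (Submodule.mapQ _ _ (Linear.rightComp k B f) (by
    rintro _ ⟨h, rfl⟩
    exact ⟨h ≫ f, by simp⟩))
  map_id M := by
    ext x
    simp
  map_comp f g := by
    ext x
    simp

/-- The class of a morphism. -/
def homClass {B L : C} (g : B ⟶ L) {M : C} : (B ⟶ M) →ₗ[k] (homQuotient k g).obj M :=
  Submodule.mkQ _

lemma homClass_surjective {B L : C} (g : B ⟶ L) {M : C} (x : (homQuotient k g).obj M) :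
    ∃ f : B ⟶ M, homClass g f = x := Submodule.mkQ_surjective _ x

lemma homClass_eq_zero {B L : C} {g : B ⟶ L} {M : C} {f : B ⟶ M} :
    (homClass g f : (homQuotient k g).obj M) = 0 ↔ ∃ h : L ⟶ M, g ≫ h = f := by
  rw [← mem_factorSubmodule (k := k)]
  exact Submodule.Quotient.mk_eq_zero _

lemma homClass_eq_iff {B L : C} {g : B ⟶ L} {M : C} {f f' : B ⟶ M} :
    (homClass g f : (homQuotient k g).obj M) = homClass g f' ↔ ∃ h : L ⟶ M, g ≫ h = f - f' := by
  rw [← homClass_eq_zero (k := k), map_sub, sub_eq_zero]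

@[simp]
lemma homQuotient_map_class {B L : C} (g : B ⟶ L) {M N : C} (φ : M ⟶ N) (f : B ⟶ M) :
    (homQuotient k g).map φ (homClass g f) = homClass g (f ≫ φ) := rfl

instance {B L : C} (g : B ⟶ L) : (homQuotient k g).Additive where
  map_add {M N φ ψ} := by
    ext x
    obtain ⟨f, rfl⟩ := homClass_surjective g x
    simp

instance {B L : C} (g : B ⟶ L) : (homQuotient k g).Linear k where
  map_smul {M N} φ r := by
    ext x
    obtain ⟨f, rfl⟩ := homClass_surjective g x
    simp

/-- A commutative square induces a natural transformation by precomposition. -/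
def homQuotientPrecomp {B₁ L₁ B₂ L₂ : C} {g₁ : B₁ ⟶ L₁} {g₂ : B₂ ⟶ L₂} (β : B₁ ⟶ B₂)
    (γ : L₁ ⟶ L₂) (h : g₁ ≫ γ = β ≫ g₂) : homQuotient k g₂ ⟶ homQuotient k g₁ where
  app M := ModuleCat.ofHom (Submodule.mapQ _ _ (Linear.leftComp k M β) (by
    rintro _ ⟨l, rfl⟩
    exact ⟨γ ≫ l, by simp [reassoc_of% h]⟩))
  naturality M N f := by
    ext x
    obtain ⟨f, rfl⟩ := homClass_surjective g₂ x
    change homClass g₁ _ = homClass g₁ _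
    simp

@[simp]
lemma homQuotientPrecomp_class {B₁ L₁ B₂ L₂ : C} {g₁ : B₁ ⟶ L₁} {g₂ : B₂ ⟶ L₂} (β : B₁ ⟶ B₂)
    (γ : L₁ ⟶ L₂) (h : g₁ ≫ γ = β ≫ g₂) {M : C} (f : B₂ ⟶ M) :
    (homQuotientPrecomp (k := k) β γ h).app M (homClass g₂ f) = homClass g₁ (β ≫ f) := rfl

/-- Representatives chosen in each component assemble to one map out of `B`. Uniqueness holds
because the factorizing maps, chosen componentwise, likewise assemble to one map out of `L`. -/
lemma homQuotient_preservesProducts {B L : C} (g : B ⟶ L) (J : Type u) :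
    PreservesLimitsOfShape (Discrete J) (homQuotient k g) where
  preservesLimit {K} := ⟨fun {c} hc => by
    refine ⟨isLimitOfReflects (forget (ModuleCat.{u} k)) (Nonempty.some ?_)⟩
    rw [Types.isLimit_iff]
    intro s hs
    choose f hf using fun j => homClass_surjective g (s j)
    let l : B ⟶ c.pt := hc.lift ⟨B, Discrete.natTrans f⟩
    have hl : ∀ j, l ≫ c.π.app j = f j := fun j => hc.fac _ j
    refine ⟨(homClass g l : (homQuotient k g).obj c.pt), fun j => ?_, fun y hy => ?_⟩
    · change homClass g (l ≫ c.π.app j) = s j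
      rw [hl, hf]
    · obtain ⟨m, rfl⟩ := homClass_surjective g y
      have : ∀ j, ∃ h : L ⟶ K.obj j, g ≫ h = m ≫ c.π.app j - f j := fun j => by
        rw [← homClass_eq_iff (k := k), hf]
        exact hy j
      choose h hh using this
      refine homClass_eq_iff.2 ⟨hc.lift ⟨L, Discrete.natTrans h⟩, hc.hom_ext fun j => ?_⟩
      rw [Category.assoc, hc.fac, Preadditive.sub_comp, hl]
      exact hh j⟩

/-- Presentability of `B` brings representatives down to a stage. That of `L` does the same for a
factorization through `g`, and the factorization identity then holds at a later stage. -/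
lemma homQuotient_preservesFilteredColimits {B L : C} (g : B ⟶ L)
    [IsFinitelyPresentable.{u} B] [IsFinitelyPresentable.{u} L] :
    PreservesFilteredColimitsOfSize.{u, u} (homQuotient k g) where
  preserves_filtered_colimits J _ _ := ⟨fun {K} => ⟨fun {c} hc => by
    refine ⟨isColimitOfReflects (forget (ModuleCat.{u} k)) ?_⟩
    refine Types.FilteredColimit.isColimitOf' _ _ ?_ ?_
    · intro x
      obtain ⟨f, rfl⟩ := homClass_surjective g x
      obtain ⟨j, p, rfl⟩ := IsFinitelyPresentable.exists_hom_of_isColimit hc f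
      exact ⟨j, (homClass g p : (homQuotient k g).obj _), rfl⟩
    · intro i x y hxy
      obtain ⟨p, rfl⟩ := homClass_surjective g x
      obtain ⟨q, rfl⟩ := homClass_surjective g y
      obtain ⟨h, hh⟩ := homClass_eq_iff.1
        (show (homClass g (p ≫ c.ι.app i) : (homQuotient k g).obj c.pt) =
          homClass g (q ≫ c.ι.app i) from hxy)
      obtain ⟨j, h, rfl⟩ := IsFinitelyPresentable.exists_hom_of_isColimit hc h
      obtain ⟨l, a, b, hab⟩ := IsFinitelyPresentable.exists_eq_of_isColimit hc (g ≫ h) (p - q)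
        (by simpa using hh)
      refine ⟨l, b, ?_⟩
      change homClass g (p ≫ K.map b) = homClass g (q ≫ K.map b)
      exact homClass_eq_iff.2 ⟨h ≫ K.map a, by simpa using hab⟩⟩⟩

end HomQuotient

/-! ### Finitely presented modules -/

section FinitelyPresented

variable {A : Type u} [Ring A]

lemma exists_map_eq_zero_of_finite {J : Type u} [SmallCategory J] [IsFiltered J]
    {K : J ⥤ ModuleCat.{u} A} {c : Cocone K} (hc : IsColimit c) {n : ℕ} {j : J}
    (x : Fin n → K.obj j) (hx : ∀ i, c.ι.app j (x i) = 0) :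
    ∃ (l : J) (a : j ⟶ l), ∀ i, K.map a (x i) = 0 := by
  induction n with
  | zero => exact ⟨j, 𝟙 j, fun i => i.elim0⟩
  | succ n ih =>
    obtain ⟨l, a, ha⟩ := ih (fun i => x i.castSucc) fun i => hx _
    obtain ⟨m, b, b', hb⟩ := Concrete.isColimit_exists_of_rep_eq K hc (x (Fin.last n))
      (0 : K.obj j) (by simpa using hx _)
    rw [map_zero] at hb
    let e := IsFiltered.coeq (a ≫ IsFiltered.leftToMax l m) (b ≫ IsFiltered.rightToMax l m)
    let q := IsFiltered.coeqHom (a ≫ IsFiltered.leftToMax l m) (b ≫ IsFiltered.rightToMax l m)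
    refine ⟨e, (a ≫ IsFiltered.leftToMax l m) ≫ q, fun i => ?_⟩
    induction i using Fin.lastCases with
    | last =>
      rw [IsFiltered.coeq_condition]
      simp [hb]
    | cast i => simp [ha]

lemma exists_rep_of_finite {J : Type u} [SmallCategory J] [IsFiltered J]
    {K : J ⥤ ModuleCat.{u} A} {c : Cocone K} (hc : IsColimit c) {n : ℕ} (x : Fin n → c.pt) :
    ∃ (j : J) (y : Fin n → K.obj j), ∀ i, c.ι.app j (y i) = x i := by
  have hw : ∀ {i j : J} (f : i ⟶ j) (z : K.obj i), c.ι.app j (K.map f z) = c.ι.app i z :=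
    fun f z => by rw [← ConcreteCategory.comp_apply, c.w]
  induction n with
  | zero => exact ⟨Classical.choice IsFiltered.nonempty, Fin.elim0, fun i => i.elim0⟩
  | succ n ih =>
    obtain ⟨j, y, hy⟩ := ih fun i => x i.castSucc
    obtain ⟨l, z, hz⟩ := Concrete.isColimit_exists_rep K hc (x (Fin.last n))
    refine ⟨IsFiltered.max j l, Fin.lastCases (K.map (IsFiltered.rightToMax j l) z)
      fun i => K.map (IsFiltered.leftToMax j l) (y i), fun i => ?_⟩
    induction i using Fin.lastCases with
    | last => simp [hw, hz]
    | cast i => simp [hw, hy]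

/-- The images of finitely many generators lift to a stage, and finitely many relations become true
at a later one. -/
lemma isFinitelyPresentable_of_finitePresentation (B : ModuleCat.{u} A)
    [Module.FinitePresentation A B] : IsFinitelyPresentable.{u} B := by
  obtain ⟨n, m, f, g, hf, hfg⟩ := Module.FinitePresentation.exists_fin' A B
  rw [isFinitelyPresentable_iff_preservesFilteredColimits]
  refine ⟨fun J _ _ => ⟨fun {K} => ⟨fun {c} hc => ⟨?_⟩⟩⟩⟩
  refine Types.FilteredColimit.isColimitOf' _ _ ?_ ?_
  · intro (x : B ⟶ c.pt)
    obtain ⟨j, y, hy⟩ := exists_rep_of_finite hc fun i => x (f (Pi.single i 1))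
    let φ : (Fin n → A) →ₗ[A] K.obj j := Fintype.linearCombination A y
    have hφ : ∀ z, c.ι.app j (φ z) = x (f z) := by
      have : (c.ι.app j).hom ∘ₗ φ = x.hom ∘ₗ f := by
        ext i
        simpa [φ, Fintype.linearCombination_apply, Pi.single_apply] using hy i
      exact fun z => LinearMap.congr_fun this z
    obtain ⟨l, a, ha⟩ := exists_map_eq_zero_of_finite hc (fun i => φ (g (Pi.single i 1)))
      fun i => by rw [hφ, hfg.apply_apply_eq_zero, map_zero]
    let ψ : (Fin n → A) →ₗ[A] K.obj l := (K.map a).hom ∘ₗ φ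
    have hψ : LinearMap.ker f ≤ LinearMap.ker ψ := by
      rw [hfg.linearMap_ker_eq, LinearMap.range_le_ker_iff]
      ext i
      simpa [ψ] using ha i
    let χ : B →ₗ[A] K.obj l :=
      (LinearMap.ker f).liftQ ψ hψ ∘ₗ (f.quotKerEquivOfSurjective hf).symm.toLinearMap
    have hχ : ∀ z, χ (f z) = ψ z := fun z => by
      have : (f.quotKerEquivOfSurjective hf).symm (f z) = Submodule.Quotient.mk z :=
        (LinearEquiv.symm_apply_eq _).2 rfl
      simp [χ, this]
    refine ⟨l, ModuleCat.ofHom χ, ?_⟩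
    change x = ModuleCat.ofHom χ ≫ c.ι.app l
    ext b
    obtain ⟨z, rfl⟩ := hf b
    have : c.ι.app l (K.map a (φ z)) = c.ι.app j (φ z) := by
      rw [← ConcreteCategory.comp_apply, c.w]
    simp [hχ, ψ, this, hφ]
  · intro i (x : B ⟶ K.obj i) (y : B ⟶ K.obj i) (h : x ≫ c.ι.app i = y ≫ c.ι.app i)
    obtain ⟨l, a, ha⟩ := exists_map_eq_zero_of_finite hc
      (fun i => (x - y) (f (Pi.single i 1))) fun j => by
        rw [← ConcreteCategory.comp_apply, Preadditive.sub_comp, h, sub_self]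
        rfl
    refine ⟨l, a, ?_⟩
    change x ≫ K.map a = y ≫ K.map a
    rw [← sub_eq_zero, ← Preadditive.sub_comp]
    ext b
    obtain ⟨z, rfl⟩ := hf b
    have : ((K.map a).hom ∘ₗ (x - y).hom) ∘ₗ f = 0 := by
      ext j
      simpa using ha j
    simpa using LinearMap.congr_fun this z

/-- Extensions of morphisms into a pure submodule along morphisms between finitely generated,
resp. finitely presented, modules. -/
lemma exists_extension_of_pure {B B' M : Type u} [AddCommGroup B] [Module A B] [Module.Finite A B]
    [AddCommGroup B'] [Module A B'] [Module.FinitePresentation A B'] [AddCommGroup M] [Module A M]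
    {N : Submodule A M} (hN : IsPureSubmodule N) (a : B →ₗ[A] B') (f : B →ₗ[A] N)
    (h : B' →ₗ[A] M) (hf : N.subtype ∘ₗ f = h ∘ₗ a) : ∃ h' : B' →ₗ[A] N, f = h' ∘ₗ a := by
  obtain ⟨n, m, p, r, hp, hpr⟩ := Module.FinitePresentation.exists_fin' A B'
  obtain ⟨q, e, he⟩ := Module.Finite.exists_fin' A B
  choose t ht using fun i => hp (a (e (Pi.single i 1)))
  have hlc : ∀ {P : Type u} [AddCommGroup P] [Module A P] (l : (Fin n → A) →ₗ[A] P)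
      (z : Fin n → A), ∑ i, z i • l (Pi.single i 1) = l z := fun l z => by
    conv_rhs => rw [pi_eq_sum_univ' z]
    rw [map_sum]
    refine Finset.sum_congr rfl fun i _ => ?_
    rw [← map_smul]
  -- The unknowns are the images of the `n` generators of `B'`. The first `m` equations are the
  -- relations of `B'`; the last `q` prescribe the values of `f` on the generators of `B`. The map
  -- `h` solves the system in `M`.
  obtain ⟨x, hx⟩ := hN n (m + q)
    (Fin.append (fun i => r (Pi.single i 1)) t)
    (Fin.append 0 (fun i => f (e (Pi.single i 1)))) ⟨fun i => h (p (Pi.single i 1)), fun j => by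
      induction j using Fin.addCases with
      | left j =>
        simp only [Fin.append_left]
        refine (hlc (h ∘ₗ p) _).trans ?_
        simp [hpr.apply_apply_eq_zero]
      | right j =>
        simp only [Fin.append_right]
        refine (hlc (h ∘ₗ p) _).trans ?_
        simpa [ht] using (LinearMap.congr_fun hf (e (Pi.single j 1))).symm⟩
  let φ : (Fin n → A) →ₗ[A] N := Fintype.linearCombination A x
  have hφ : LinearMap.ker p ≤ LinearMap.ker φ := by
    rw [hpr.linearMap_ker_eq, LinearMap.range_le_ker_iff]
    ext j
    simpa [φ, Fintype.linearCombination_apply] using congrArg Subtype.val (hx (Fin.castAdd q j))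
  let χ : B' →ₗ[A] N :=
    (LinearMap.ker p).liftQ φ hφ ∘ₗ (p.quotKerEquivOfSurjective hp).symm.toLinearMap
  have hχ : ∀ z, χ (p z) = φ z := fun z => by
    have : (p.quotKerEquivOfSurjective hp).symm (p z) = Submodule.Quotient.mk z :=
      (LinearEquiv.symm_apply_eq _).2 rfl
    simp [χ, this]
  refine ⟨χ, ?_⟩
  have : f ∘ₗ e = (χ ∘ₗ a) ∘ₗ e := by
    ext j
    have := congrArg Subtype.val (hx (Fin.natAdd m j))
    simpa [φ, Fintype.linearCombination_apply, hχ, ← ht] using this.symm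
  ext b
  obtain ⟨z, rfl⟩ := he b
  exact congrArg Subtype.val (LinearMap.congr_fun this z)

end FinitelyPresented

/-! ### Modules over an algebra from operators on a functor -/

section Operators

variable {k : Type u} [Field k] {C : Type (u + 1)} [Category.{u} C]
  {V₂ V₁ : C ⥤ ModuleCat.{u} k} {ι : Type u} (τ : Option ι → (V₂ ⟶ V₁))

/-- The operators `τ none ⁻¹ ∘ τ i` and the action of the free algebra that they generate. -/
noncomputable def freeAction (M : C) [IsIso ((τ none).app M)] :
    FreeAlgebra k ι →ₐ[k] Module.End k (V₂.obj M) :=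
  FreeAlgebra.lift k fun i => ((τ (some i)).app M ≫ inv ((τ none).app M)).hom

lemma freeAction_ι (M : C) [IsIso ((τ none).app M)] (i : ι) (x : V₂.obj M) :
    freeAction τ M (FreeAlgebra.ι k i) x = inv ((τ none).app M) ((τ (some i)).app M x) := by
  simp [freeAction]

lemma freeAction_eq_of_semiconj {k : Type*} [Field k] {ι V W : Type*} [AddCommGroup V] [Module k V]
    [AddCommGroup W] [Module k W] (ρ : FreeAlgebra k ι →ₐ[k] Module.End k V)
    (σ : FreeAlgebra k ι →ₐ[k] Module.End k W) (f : V →ₗ[k] W)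
    (h : ∀ i x, f (ρ (FreeAlgebra.ι k i) x) = σ (FreeAlgebra.ι k i) (f x)) (p : FreeAlgebra k ι)
    (x : V) : f (ρ p x) = σ p (f x) := by
  induction p using FreeAlgebra.induction generalizing x with
  | grade0 r => simp [Module.algebraMap_end_apply]
  | grade1 i => exact h i x
  | mul a b ha hb => simp [ha, hb]
  | add a b ha hb => simp [ha, hb]

lemma freeAction_map {M N : C} [IsIso ((τ none).app M)] [IsIso ((τ none).app N)] (f : M ⟶ N)
    (p : FreeAlgebra k ι) (x : V₂.obj M) :
    V₂.map f (freeAction τ M p x) = freeAction τ N p (V₂.map f x) := by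
  refine freeAction_eq_of_semiconj (freeAction τ M) (freeAction τ N) (V₂.map f).hom
    (fun i x => ?_) p x
  rw [freeAction_ι, freeAction_ι]
  simp only [← ConcreteCategory.comp_apply]
  change ((τ (some i)).app M ≫ inv ((τ none).app M) ≫ V₂.map f) x =
    (V₂.map f ≫ (τ (some i)).app N ≫ inv ((τ none).app N)) x
  congr 2
  rw [(τ (some i)).naturality_assoc]
  congr 1
  rw [IsIso.inv_comp_eq, ← (τ none).naturality_assoc]
  simp

variable {S : Type u} [Ring S] [Algebra k S] (π : FreeAlgebra k ι →ₐ[k] S)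

/-- The objects `M` for which `τ none` is invertible and the action of the free algebra on `V₂ M`
factors through `π`. -/
def operatorObjects : ObjectProperty C := fun M =>
  ∃ _ : IsIso ((τ none).app M), ∀ p, π p = 0 → freeAction τ M p = 0

/-- The action is natural in `M`, so relations pass to anything that `V₂` embeds jointly into good
objects: this serves isomorphisms, products and pure submodules. -/
lemma operatorObjects_of_jointly_injective {M : C} [IsIso ((τ none).app M)] {J : Type*}
    (N : J → C) (hN : ∀ j, operatorObjects τ π (N j)) (f : ∀ j, M ⟶ N j)
    (hf : ∀ x : V₂.obj M, (∀ j, V₂.map (f j) x = 0) → x = 0) : operatorObjects τ π M := by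
  refine ⟨inferInstance, fun p hp => LinearMap.ext fun x => hf _ fun j => ?_⟩
  obtain ⟨_, h⟩ := hN j
  rw [freeAction_map, h p hp]
  rfl

/-- The dual transfer, used for filtered colimits, where each vector comes from a stage. -/
lemma operatorObjects_of_jointly_surjective {M : C} [IsIso ((τ none).app M)] {J : Type*}
    (N : J → C) (hN : ∀ j, operatorObjects τ π (N j)) (f : ∀ j, N j ⟶ M)
    (hf : ∀ x : V₂.obj M, ∃ j y, V₂.map (f j) y = x) : operatorObjects τ π M := by
  refine ⟨inferInstance, fun p hp => LinearMap.ext fun x => ?_⟩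
  obtain ⟨j, y, rfl⟩ := hf x
  obtain ⟨_, h⟩ := hN j
  rw [← freeAction_map, h p hp]
  simp

instance : (operatorObjects τ π).IsClosedUnderIsomorphisms where
  of_iso {M N} e hM := by
    obtain ⟨_, _⟩ := id hM
    have : IsIso ((τ none).app N) := (NatTrans.isIso_app_iff_of_iso (τ none) e).1 inferInstance
    refine operatorObjects_of_jointly_injective τ π (J := Unit) (fun _ => M) (fun _ => hM)
      (fun _ => e.inv) fun x hx => ?_
    have := congrArg (V₂.map e.hom) (hx ())
    rwa [← ConcreteCategory.comp_apply, ← V₂.map_comp, e.inv_hom_id, V₂.map_id, map_zero] at this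

lemma operatorObjects_closedUnderLimits (J : Type u) [SmallCategory J]
    [PreservesLimitsOfShape J V₂] [PreservesLimitsOfShape J V₁] :
    (operatorObjects τ π).IsClosedUnderLimitsOfShape J where
  limitsOfShape_le := by
    rintro M ⟨h⟩
    have : ∀ j, IsIso ((Functor.whiskerLeft h.diag (τ none)).app j) :=
      fun j => (h.prop_diag_obj j).1
    have : IsIso (Functor.whiskerLeft h.diag (τ none)) := NatIso.isIso_of_isIso_app _
    have h₂ := isLimitOfPreserves V₂ h.isLimit
    have h₁ := isLimitOfPreserves V₁ h.isLimit
    have : IsIso ((τ none).app M) := by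
      -- At the limit, `τ none` is the limit of the isomorphisms at the stages.
      have e : (τ none).app M = (IsLimit.conePointsIsoOfNatIso h₂ h₁
          (asIso (Functor.whiskerLeft h.diag (τ none)))).hom := by
        refine h₁.hom_ext fun j => Eq.trans ?_
          (IsLimit.conePointsIsoOfNatIso_hom_comp h₂ h₁ _ j).symm
        exact ((τ none).naturality _).symm
      rw [e]
      infer_instance
    refine operatorObjects_of_jointly_injective τ π _ h.prop_diag_obj (fun j => h.π.app j)
      fun x hx => ?_
    exact Concrete.isLimit_ext _ h₂ x 0 fun j => (hx j).trans (map_zero _).symm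

lemma operatorObjects_closedUnderFilteredColimits (J : Type u) [SmallCategory J] [IsFiltered J]
    [PreservesColimitsOfShape J V₂] [PreservesColimitsOfShape J V₁] :
    (operatorObjects τ π).IsClosedUnderColimitsOfShape J where
  colimitsOfShape_le := by
    rintro M ⟨h⟩
    have : ∀ j, IsIso ((Functor.whiskerLeft h.diag (τ none)).app j) :=
      fun j => (h.prop_diag_obj j).1
    have : IsIso (Functor.whiskerLeft h.diag (τ none)) := NatIso.isIso_of_isIso_app _
    have h₂ := isColimitOfPreserves V₂ h.isColimit
    have h₁ := isColimitOfPreserves V₁ h.isColimit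
    have : IsIso ((τ none).app M) := by
      have e : (τ none).app M = (IsColimit.coconePointsIsoOfNatIso h₂ h₁
          (asIso (Functor.whiskerLeft h.diag (τ none)))).hom := by
        refine h₂.hom_ext fun j => Eq.trans ?_
          (IsColimit.comp_coconePointsIsoOfNatIso_hom h₂ h₁ _ j).symm
        exact (τ none).naturality _
      rw [e]
      infer_instance
    refine operatorObjects_of_jointly_surjective τ π _ h.prop_diag_obj (fun j => h.ι.app j)
      fun x => ?_
    exact Concrete.isColimit_exists_rep _ h₂ x

variable {τ π}

/-- The action of the algebra `S` on `V₂ M`. -/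
noncomputable def operatorAction (hπ : Function.Surjective π) {M : C}
    (hM : operatorObjects τ π M) : S →+* Module.End k (V₂.obj M) :=
  haveI := hM.1
  RingHom.liftOfSurjective (π : FreeAlgebra k ι →+* S) hπ
    ⟨(freeAction τ M : FreeAlgebra k ι →+* Module.End k (V₂.obj M)), by
      intro p hp
      exact hM.2 p hp⟩

lemma operatorAction_apply (hπ : Function.Surjective π) {M : C} [IsIso ((τ none).app M)]
    (hM : operatorObjects τ π M) (p : FreeAlgebra k ι) :
    operatorAction hπ hM (π p) = freeAction τ M p :=
  RingHom.liftOfRightInverse_comp_apply (π : FreeAlgebra k ι →+* S) _ _ _ p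

/-- The functor to `S`-modules defined by the operators. -/
noncomputable def operatorFunctor (hπ : Function.Surjective π) :
    (operatorObjects τ π).FullSubcategory ⥤ ModuleCat.{u} S where
  obj M := @ModuleCat.of S _ (V₂.obj M.obj) _
    (Module.compHom (V₂.obj M.obj) (operatorAction hπ M.property))
  map {M N} f :=
    letI := Module.compHom (V₂.obj M.obj) (operatorAction hπ M.property)
    letI := Module.compHom (V₂.obj N.obj) (operatorAction hπ N.property)
    ModuleCat.ofHom
      { toFun := V₂.map f.hom
        map_add' := map_add _
        map_smul' := fun s x => by
          obtain ⟨p, rfl⟩ := hπ s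
          have := M.property.1
          have := N.property.1
          change V₂.map f.hom (operatorAction hπ M.property (π p) x) =
            operatorAction hπ N.property (π p) (V₂.map f.hom x)
          rw [operatorAction_apply, operatorAction_apply, freeAction_map] }
  map_id M := by
    ext x
    exact congrArg (fun f => f.hom x) (V₂.map_id M.obj)
  map_comp f g := by
    ext x
    exact congrArg (fun h => h.hom x) (V₂.map_comp f.hom g.hom)

lemma operatorFunctor_smul (hπ : Function.Surjective π)
    (M : (operatorObjects τ π).FullSubcategory) [IsIso ((τ none).app M.obj)]
    (p : FreeAlgebra k ι) (x : (operatorFunctor hπ).obj M) :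
    π p • x = freeAction τ M.obj p x := by
  rw [← operatorAction_apply hπ M.property]
  rfl

/-- The underlying set of the module is that of `V₂ M`. -/
noncomputable def operatorFunctorCompForget (hπ : Function.Surjective π) :
    operatorFunctor hπ ⋙ forget (ModuleCat.{u} S) ≅
      (operatorObjects τ π).ι ⋙ V₂ ⋙ forget (ModuleCat.{u} k) :=
  Iso.refl _

lemma operatorFunctor_preservesLimitsOfShape (hπ : Function.Surjective π) (J : Type u)
    [SmallCategory J] [HasLimitsOfShape J C] [PreservesLimitsOfShape J V₂]
    [PreservesLimitsOfShape J V₁] :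
    PreservesLimitsOfShape J (operatorFunctor (V₂ := V₂) (V₁ := V₁) (τ := τ) hπ) := by
  have := operatorObjects_closedUnderLimits τ π J
  have := preservesLimitsOfShape_of_natIso (J := J)
    (operatorFunctorCompForget (V₂ := V₂) (V₁ := V₁) (τ := τ) hπ).symm
  exact preservesLimitsOfShape_of_reflects_of_preserves _ (forget (ModuleCat.{u} S))

lemma operatorFunctor_preservesFilteredColimits (hπ : Function.Surjective π)
    [HasFilteredColimitsOfSize.{u, u} C] [PreservesFilteredColimitsOfSize.{u, u} V₂]
    [PreservesFilteredColimitsOfSize.{u, u} V₁] :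
    PreservesFilteredColimits (operatorFunctor (V₂ := V₂) (V₁ := V₁) (τ := τ) hπ) where
  preserves_filtered_colimits J _ _ := by
    have := operatorObjects_closedUnderFilteredColimits τ π J
    have := preservesColimitsOfShape_of_natIso (J := J)
      (operatorFunctorCompForget (V₂ := V₂) (V₁ := V₁) (τ := τ) hπ).symm
    exact preservesColimitsOfShape_of_reflects_of_preserves _ (forget (ModuleCat.{u} S))

lemma operatorFunctor_additive [Preadditive C] [V₂.Additive] (hπ : Function.Surjective π) :
    (operatorFunctor (V₂ := V₂) (V₁ := V₁) (τ := τ) hπ).Additive where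
  map_add {M N f g} := by
    ext x
    exact congrArg (fun h => h.hom x) (V₂.map_add (f := f.hom) (g := g.hom))

lemma operatorFunctor_linear [Preadditive C] [Linear k C] [V₂.Additive] [V₂.Linear k]
    (hπ : Function.Surjective π) :
    (operatorFunctor (V₂ := V₂) (V₁ := V₁) (τ := τ) hπ).Linear k where
  map_smul {M N} f r := by
    ext x
    refine (congrArg (fun h => h.hom x) (V₂.map_smul r f.hom)).trans ?_
    have := N.property.1
    change r • V₂.map f.hom x = algebraMap k S r • (operatorFunctor hπ).map f x
    rw [← π.commutes, operatorFunctor_smul, AlgHom.commutes]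
    rfl

/-- An object of `C` on which `V₂`, `V₁` and `τ` take given values. -/
lemma exists_operatorFunctor_iso (hπ : Function.Surjective π) (N : ModuleCat.{u} S)
    [Module k N] [IsScalarTower k S N] (M : C) (e₂ : V₂.obj M ≃ₗ[k] N) (e₁ : V₁.obj M ≃ₗ[k] N)
    (h₀ : ∀ x, e₁ ((τ none).app M x) = e₂ x)
    (h : ∀ i x, e₁ ((τ (some i)).app M x) = π (FreeAlgebra.ι k i) • e₂ x) :
    ∃ hM : operatorObjects τ π M, Nonempty ((operatorFunctor hπ).obj ⟨M, hM⟩ ≅ N) := by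
  have : IsIso ((τ none).app M) := by
    have : (τ none).app M = (e₂ ≪≫ₗ e₁.symm).toModuleIso.hom := by
      ext x
      exact (e₁.eq_symm_apply).2 (h₀ x)
    rw [this]
    infer_instance
  have hact : ∀ p x, e₂ (freeAction τ M p x) = π p • e₂ x := by
    let σ : FreeAlgebra k ι →ₐ[k] Module.End k N := (Algebra.lsmul k k N).comp π
    refine freeAction_eq_of_semiconj (freeAction τ M) σ e₂.toLinearMap fun i x => ?_
    rw [freeAction_ι]
    change e₂ _ = π (FreeAlgebra.ι k i) • e₂ x
    rw [← h₀, ← h, ← ConcreteCategory.comp_apply]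
    simp
  have hM : operatorObjects τ π M := ⟨this, fun p hp => LinearMap.ext fun x => e₂.injective (by
    rw [hact, hp, zero_smul]
    simp)⟩
  let e : (operatorFunctor hπ).obj ⟨M, hM⟩ ≃ₗ[S] N :=
    { toFun := e₂
      invFun := e₂.symm
      left_inv := e₂.left_inv
      right_inv := e₂.right_inv
      map_add' := e₂.map_add
      map_smul' := fun s x => by
        obtain ⟨p, rfl⟩ := hπ s
        rw [operatorFunctor_smul hπ ⟨M, hM⟩ p x]
        exact hact p x }
  exact ⟨hM, ⟨e.toModuleIso⟩⟩

end Operators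

/-! ### The definable subcategory -/

section Definable

variable {k : Type u} [Field k] {A : Type u} [Ring A] [Algebra k A]

/-- If a map into a pure submodule factors through `g` inside `M`, purity moves the factorization
into `N`. -/
lemma homQuotient_subtype_injective {B L M : ModuleCat.{u} A} (g : B ⟶ L) [Module.Finite A B]
    [Module.FinitePresentation A L] {N : Submodule A M} (hN : IsPureSubmodule N)
    (x : (homQuotient k g).obj (ModuleCat.of A N))
    (hx : (homQuotient k g).map (ModuleCat.ofHom N.subtype) x = 0) : x = 0 := by
  obtain ⟨f, rfl⟩ := homClass_surjective g x
  obtain ⟨h, hh⟩ := homClass_eq_zero.1 hx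
  obtain ⟨h', hh'⟩ := exists_extension_of_pure hN g.hom f.hom h.hom
    (congrArg ModuleCat.Hom.hom hh.symm)
  exact homClass_eq_zero.2 ⟨ModuleCat.ofHom h', ModuleCat.hom_ext hh'.symm⟩

lemma homQuotientPrecomp_surjective_of_pure {B₁ L₁ B₂ L₂ M : ModuleCat.{u} A}
    [Module.Finite A B₁] [Module.FinitePresentation A L₁] [Module.FinitePresentation A B₂]
    {g₁ : B₁ ⟶ L₁} {g₂ : B₂ ⟶ L₂} (β : B₁ ⟶ B₂) (γ : L₁ ⟶ L₂) (hβ : g₁ ≫ γ = β ≫ g₂)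
    {N : Submodule A M} (hN : IsPureSubmodule N)
    (hM : Function.Surjective ((homQuotientPrecomp (k := k) β γ hβ).app M)) :
    Function.Surjective ((homQuotientPrecomp (k := k) β γ hβ).app (ModuleCat.of A N)) := by
  intro x
  obtain ⟨f, rfl⟩ := homClass_surjective g₁ x
  obtain ⟨y, hy⟩ := hM (homClass g₁ (f ≫ ModuleCat.ofHom N.subtype))
  obtain ⟨v, rfl⟩ := homClass_surjective g₂ y
  obtain ⟨l, hl⟩ := homClass_eq_iff.1 hy
  -- That the class of `f` lies in the image means precisely that `f` extends along `(β, g₁) : B₁ →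
  -- B₂ × L₁`. Such an extension over `M` can be replaced by one into `N`.
  obtain ⟨h', hh'⟩ := exists_extension_of_pure hN (LinearMap.prod β.hom g₁.hom) f.hom
    (LinearMap.coprod v.hom (-l.hom)) (by
      ext b
      have := congrArg (fun φ => φ.hom b) hl
      simp only [ModuleCat.hom_comp, LinearMap.comp_apply, ModuleCat.hom_sub,
        LinearMap.sub_apply] at this
      simp [this])
  refine ⟨homClass g₂ (ModuleCat.ofHom (h' ∘ₗ LinearMap.inl A B₂ L₁)), ?_⟩
  rw [homQuotientPrecomp_class, eq_comm, homClass_eq_iff]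
  refine ⟨ModuleCat.ofHom (h' ∘ₗ LinearMap.inr A B₂ L₁), ?_⟩
  ext b
  have : f.hom b = h' (β.hom b, g₁.hom b) := LinearMap.congr_fun hh' b
  have e : (β.hom b, g₁.hom b) = (β.hom b, 0) + (0, g₁.hom b) := by simp
  rw [e, map_add] at this
  simp [this]

variable {B₁ L₁ B₂ L₂ : ModuleCat.{u} A} [Module.FinitePresentation A B₁]
  [Module.FinitePresentation A L₁] [Module.FinitePresentation A B₂]
  [Module.FinitePresentation A L₂] {g₁ : B₁ ⟶ L₁} {g₂ : B₂ ⟶ L₂} {ι : Type u}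
  (β : Option ι → (B₁ ⟶ B₂)) (γ : Option ι → (L₁ ⟶ L₂)) (h : ∀ i, g₁ ≫ γ i = β i ≫ g₂)
  {S : Type u} [Ring S] [Algebra k S] (π : FreeAlgebra k ι →ₐ[k] S)

lemma operatorObjects_closedUnderPure {M : ModuleCat.{u} A} {N : Submodule A M}
    (hN : IsPureSubmodule N)
    (hM : operatorObjects (fun i => homQuotientPrecomp (k := k) (β i) (γ i) (h i)) π M) :
    operatorObjects (fun i => homQuotientPrecomp (k := k) (β i) (γ i) (h i)) π
      (ModuleCat.of A N) := by
  have hb := (ConcreteCategory.isIso_iff_bijective _).1 hM.1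
  have : IsIso ((homQuotientPrecomp (k := k) (β none) (γ none) (h none)).app
      (ModuleCat.of A N)) := by
    rw [ConcreteCategory.isIso_iff_bijective]
    refine ⟨(injective_iff_map_eq_zero _).2 fun x hx => ?_,
      homQuotientPrecomp_surjective_of_pure _ _ _ hN hb.2⟩
    refine homQuotient_subtype_injective g₂ hN x ((injective_iff_map_eq_zero _).1 hb.1 _ ?_)
    rw [← ConcreteCategory.comp_apply, NatTrans.naturality, ConcreteCategory.comp_apply]
    exact (congrArg _ hx).trans (map_zero _)
  exact operatorObjects_of_jointly_injective _ π (J := Unit) (fun _ => M) (fun _ => hM)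
    (fun _ => ModuleCat.ofHom N.subtype) fun x hx => homQuotient_subtype_injective g₂ hN x (hx ())

end Definable

/-! ### Modules over the free algebra in two generators -/

section PairModule

variable {k : Type u} [Field k] {Z Z' Z'' : Type u} [AddCommGroup Z] [Module k Z]
  [AddCommGroup Z'] [Module k Z'] [AddCommGroup Z''] [Module k Z'']

/-- The action of the opposite free algebra given by two operators. -/
noncomputable def pairAction (X Y : Module.End k Z) :
    (FreeAlgebra k (Fin 2))ᵐᵒᵖ →ₐ[k] Module.End k Z :=
  -- Right modules correspond to algebra maps from the free algebra to the opposite of the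
  -- endomorphism ring.
  AlgHom.opComm (FreeAlgebra.lift k ![MulOpposite.op X, MulOpposite.op Y])

lemma pairAction_zero (X Y : Module.End k Z) :
    pairAction X Y (MulOpposite.op (FreeAlgebra.ι k 0)) = X := by
  simp [pairAction, AlgHom.opComm]

lemma pairAction_one (X Y : Module.End k Z) :
    pairAction X Y (MulOpposite.op (FreeAlgebra.ι k 1)) = Y := by
  simp [pairAction, AlgHom.opComm]

lemma pairAction_semiconj {X Y : Module.End k Z} {X' Y' : Module.End k Z'} (f : Z →ₗ[k] Z')
    (hX : ∀ z, f (X z) = X' (f z)) (hY : ∀ z, f (Y z) = Y' (f z))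
    (a : (FreeAlgebra k (Fin 2))ᵐᵒᵖ) (z : Z) :
    f (pairAction X Y a z) = pairAction X' Y' a (f z) := by
  induction a using MulOpposite.rec' with | _ a
  induction a using FreeAlgebra.induction generalizing z with
  | grade0 r =>
    change f (pairAction X Y (algebraMap k _ r) z) = pairAction X' Y' (algebraMap k _ r) (f z)
    rw [AlgHom.commutes, AlgHom.commutes, Module.algebraMap_end_apply,
      Module.algebraMap_end_apply, map_smul]
  | grade1 i =>
    fin_cases i
    · simpa [pairAction_zero] using hX z
    · simpa [pairAction_one] using hY z
  | mul a b ha hb => simp [ha, hb]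
  | add a b ha hb => simp [ha, hb]

/-- A finite-dimensional space with two operators as a module. -/
noncomputable def pairModule [Module.Finite k Z] (X Y : Module.End k Z) :
    FinMod k (FreeAlgebra k (Fin 2)) where
  obj := @ModuleCat.of (FreeAlgebra k (Fin 2))ᵐᵒᵖ _ Z _
    (Module.compHom Z (pairAction X Y : (FreeAlgebra k (Fin 2))ᵐᵒᵖ →+* Module.End k Z))
  property := by
    let m := Module.compHom Z (pairAction X Y : (FreeAlgebra k (Fin 2))ᵐᵒᵖ →+* Module.End k Z)
    let M : ModuleCat (FreeAlgebra k (Fin 2))ᵐᵒᵖ := ModuleCat.of _ Z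
    change @Module.Finite k M _ _ (ModuleCat.moduleOfAlgebraModule M)
    let e : @LinearMap k k _ _ (RingHom.id k) Z M _ _ _ (ModuleCat.moduleOfAlgebraModule M) :=
      @LinearMap.mk _ _ _ _ _ _ _ _ _ _ (ModuleCat.moduleOfAlgebraModule M)
        { toFun := fun z => z, map_add' := fun _ _ => rfl } (fun c z => by
          change c • z = pairAction X Y (algebraMap k _ c) z
          rw [AlgHom.commutes, Module.algebraMap_end_apply])
    exact @Module.Finite.of_surjective k Z _ _ _ k M _ _ (ModuleCat.moduleOfAlgebraModule M)
      (RingHom.id k) ‹_› e fun z => ⟨z, rfl⟩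

variable [Module.Finite k Z] [Module.Finite k Z'] [Module.Finite k Z'']
  {X Y : Module.End k Z} {X' Y' : Module.End k Z'} {X'' Y'' : Module.End k Z''}

/-- Linear maps that commute with the operators. -/
noncomputable def pairHom (f : Z →ₗ[k] Z') (hX : ∀ z, f (X z) = X' (f z))
    (hY : ∀ z, f (Y z) = Y' (f z)) : pairModule X Y ⟶ pairModule X' Y' :=
  ObjectProperty.homMk (@ModuleCat.ofHom _ _ Z Z' _
    (Module.compHom Z (pairAction X Y : (FreeAlgebra k (Fin 2))ᵐᵒᵖ →+* Module.End k Z)) _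
    (Module.compHom Z' (pairAction X' Y' : (FreeAlgebra k (Fin 2))ᵐᵒᵖ →+* Module.End k Z'))
    (@LinearMap.mk _ _ _ _ _ _ _ _ _
      (Module.compHom Z (pairAction X Y : (FreeAlgebra k (Fin 2))ᵐᵒᵖ →+* Module.End k Z))
      (Module.compHom Z' (pairAction X' Y' : (FreeAlgebra k (Fin 2))ᵐᵒᵖ →+* Module.End k Z'))
      f.toAddHom (pairAction_semiconj f hX hY)))

lemma pairModule_hom_action (φ : pairModule X Y ⟶ pairModule X' Y')
    (a : (FreeAlgebra k (Fin 2))ᵐᵒᵖ) (z : Z) :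
    φ.hom.hom (pairAction X Y a z) = pairAction X' Y' a (φ.hom.hom z) :=
  let z' : (pairModule X Y).obj := z
  map_smul φ.hom.hom a z'

/-- The underlying linear map of a morphism. -/
noncomputable def pairHomLinear (φ : pairModule X Y ⟶ pairModule X' Y') : Z →ₗ[k] Z' where
  toFun z := φ.hom.hom z
  map_add' := map_add φ.hom.hom
  map_smul' c z := by
    have := pairModule_hom_action φ (algebraMap k _ c) z
    rw [AlgHom.commutes, AlgHom.commutes] at this
    exact this

lemma pairHomLinear_injective :
    Function.Injective (pairHomLinear : (pairModule X Y ⟶ pairModule X' Y') → (Z →ₗ[k] Z')) :=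
  fun φ ψ h => by
    ext z
    exact LinearMap.congr_fun h z

@[simp]
lemma pairHomLinear_comp (φ : pairModule X Y ⟶ pairModule X' Y')
    (ψ : pairModule X' Y' ⟶ pairModule X'' Y'') :
    pairHomLinear (φ ≫ ψ) = pairHomLinear ψ ∘ₗ pairHomLinear φ := rfl

@[simp]
lemma pairHomLinear_add (φ ψ : pairModule X Y ⟶ pairModule X' Y') :
    pairHomLinear (φ + ψ) = pairHomLinear φ + pairHomLinear ψ := rfl

@[simp]
lemma pairHomLinear_smul (c : k) (φ : pairModule X Y ⟶ pairModule X' Y') :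
    pairHomLinear (c • φ) = c • pairHomLinear φ := by
  ext z
  change pairAction X' Y' (algebraMap k _ c) (φ.hom.hom z) = _
  rw [AlgHom.commutes]
  rfl

lemma pairHomLinear_zero_op (φ : pairModule X Y ⟶ pairModule X' Y') (z : Z) :
    pairHomLinear φ (X z) = X' (pairHomLinear φ z) := by
  have := pairModule_hom_action φ (MulOpposite.op (FreeAlgebra.ι k 0)) z
  rw [pairAction_zero, pairAction_zero] at this
  exact this

lemma pairHomLinear_one_op (φ : pairModule X Y ⟶ pairModule X' Y') (z : Z) :
    pairHomLinear φ (Y z) = Y' (pairHomLinear φ z) := by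
  have := pairModule_hom_action φ (MulOpposite.op (FreeAlgebra.ι k 1)) z
  rw [pairAction_one, pairAction_one] at this
  exact this

end PairModule

/-! ### Encoding several operators by two -/

section Encoding

variable {k : Type u} [Field k] {V W : Type u} [AddCommGroup V] [Module k V]
  [AddCommGroup W] [Module k W]

variable (k V) in
/-- The nilpotent shift on `V ^ m`. -/
def shiftDown (m : ℕ) : Module.End k (Fin m → V) where
  toFun z i := if h : i.val + 1 < m then z ⟨i + 1, h⟩ else 0
  map_add' z w := by
    ext i
    by_cases h : i.val + 1 < m <;> simp [h]
  map_smul' c z := by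
    ext i
    by_cases h : i.val + 1 < m <;> simp [h]

/-- The shift in the opposite direction with operators as weights. -/
def weightedShift (m : ℕ) (y : ℕ → Module.End k V) : Module.End k (Fin m → V) where
  toFun z i := if 0 < i.val then y (i - 1) (z ⟨i - 1, by omega⟩) else 0
  map_add' z w := by
    ext i
    by_cases h : 0 < i.val <;> simp [h]
  map_smul' c z := by
    ext i
    by_cases h : 0 < i.val <;> simp [h]

lemma shiftDown_apply_of_lt {m : ℕ} {i : Fin m} (h : i.val + 1 < m) (z : Fin m → V) :
    shiftDown k V m z i = z ⟨i + 1, h⟩ := dif_pos h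

lemma shiftDown_apply_of_not_lt {m : ℕ} {i : Fin m} (h : ¬ i.val + 1 < m) (z : Fin m → V) :
    shiftDown k V m z i = 0 := dif_neg h

lemma weightedShift_apply_of_pos {m : ℕ} (y : ℕ → Module.End k V) {i : Fin m} (h : 0 < i.val)
    (z : Fin m → V) : weightedShift m y z i = y (i - 1) (z ⟨i - 1, by omega⟩) := if_pos h

lemma weightedShift_apply_of_eq_zero {m : ℕ} (y : ℕ → Module.End k V) {i : Fin m}
    (h : i.val = 0) (z : Fin m → V) : weightedShift m y z i = 0 := if_neg (by omega)

lemma shiftDown_single {m : ℕ} (j : Fin m) (v : V) :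
    shiftDown k V m (Pi.single j v) =
      if h : 0 < j.val then Pi.single ⟨j - 1, by omega⟩ v else 0 := by
  ext i
  by_cases hi : i.val + 1 < m
  · rw [shiftDown_apply_of_lt hi]
    by_cases hj : 0 < j.val
    · rw [dif_pos hj, Pi.single_apply, Pi.single_apply]
      congr 1
      simp only [Fin.ext_iff, eq_iff_iff]
      omega
    · rw [dif_neg hj, Pi.single_eq_of_ne (by simp [Fin.ext_iff]; omega)]
      rfl
  · rw [shiftDown_apply_of_not_lt hi]
    split_ifs with hj
    · rw [Pi.single_eq_of_ne (by simp [Fin.ext_iff]; omega)]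
    · rfl

lemma weightedShift_single {m : ℕ} (y : ℕ → Module.End k V) (j : Fin m) (v : V) :
    weightedShift m y (Pi.single j v) =
      if h : j.val + 1 < m then Pi.single ⟨j + 1, h⟩ (y j v) else 0 := by
  ext i
  rcases Nat.eq_zero_or_pos i.val with hi | hi
  · rw [weightedShift_apply_of_eq_zero y hi]
    split_ifs with hj
    · rw [Pi.single_eq_of_ne (by simp [Fin.ext_iff]; omega)]
    · rfl
  · rw [weightedShift_apply_of_pos y hi]
    by_cases hij : i.val = j + 1
    · obtain ⟨i, h⟩ := i
      obtain ⟨j, h'⟩ := j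
      obtain rfl : i = j + 1 := hij
      simp [h]
    · rw [Pi.single_eq_of_ne (by simp [Fin.ext_iff]; omega), map_zero]
      split_ifs
      · rw [Pi.single_eq_of_ne (by simp [Fin.ext_iff]; omega)]
      · rfl

/-- A map that commutes with both shifts is diagonal when half of the weights are identities. -/
lemma eq_diagonal_of_commute_shifts {r : ℕ} {y : ℕ → Module.End k V} {y' : ℕ → Module.End k W}
    (hy : ∀ j < r, y j = 1) (hy' : ∀ j < r, y' j = 1)
    (f : (Fin (2 * r + 1) → V) →ₗ[k] (Fin (2 * r + 1) → W))
    (hX : ∀ z, f (shiftDown k V _ z) = shiftDown k W _ (f z))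
    (hY : ∀ z, f (weightedShift _ y z) = weightedShift _ y' (f z)) :
    ∃ ψ : V →ₗ[k] W, (∀ z i, f z i = ψ (z i)) ∧ ∀ j < 2 * r, ∀ v, ψ (y j v) = y' j (ψ v) := by
  -- The block entries of `f`. Commuting with the unweighted shift makes them constant along
  -- diagonals and zero below the main one.
  let a (i j : Fin (2 * r + 1)) (v : V) : W := f (Pi.single j v) i
  have hXs : ∀ (i j : Fin (2 * r + 1)) (hi : i.val + 1 < 2 * r + 1) (hj : 0 < j.val) v,
      a ⟨i + 1, hi⟩ j v = a i ⟨j - 1, by omega⟩ v := fun i j hi hj v => by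
    have := congrFun (hX (Pi.single j v)) i
    rw [shiftDown_single, dif_pos hj] at this
    rwa [shiftDown_apply_of_lt hi, eq_comm] at this
  have hX0 : ∀ (i j : Fin (2 * r + 1)) (hi : i.val + 1 < 2 * r + 1) (hj : j.val = 0) v,
      a ⟨i + 1, hi⟩ j v = 0 := fun i j hi hj v => by
    have := congrFun (hX (Pi.single j v)) i
    rw [shiftDown_single, dif_neg (by omega)] at this
    rw [shiftDown_apply_of_lt hi, map_zero, eq_comm] at this
    exact this
  have hYs : ∀ (i j : Fin (2 * r + 1)) (hi : 0 < i.val) (hj : j.val + 1 < 2 * r + 1) v,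
      a i ⟨j + 1, hj⟩ (y j v) = y' (i - 1) (a ⟨i - 1, by omega⟩ j v) := fun i j hi hj v => by
    have := congrFun (hY (Pi.single j v)) i
    rw [weightedShift_single, dif_pos hj] at this
    rwa [weightedShift_apply_of_pos y' hi] at this
  have hYl : ∀ (i j : Fin (2 * r + 1)) (hi : 0 < i.val) (hj : ¬ j.val + 1 < 2 * r + 1) v,
      y' (i - 1) (a ⟨i - 1, by omega⟩ j v) = 0 := fun i j hi hj v => by
    have := congrFun (hY (Pi.single j v)) i
    rw [weightedShift_single, dif_neg hj] at this
    rw [weightedShift_apply_of_pos y' hi, map_zero, eq_comm] at this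
    exact this
  have hYf : ∀ (i j : Fin (2 * r + 1)) (hi : i.val = 0) (hj : j.val + 1 < 2 * r + 1) v,
      a i ⟨j + 1, hj⟩ (y j v) = 0 := fun i j hi hj v => by
    have := congrFun (hY (Pi.single j v)) i
    rw [weightedShift_single, dif_pos hj] at this
    rwa [weightedShift_apply_of_eq_zero y' hi] at this
  have toeplitz : ∀ n (i j i' j' : Fin (2 * r + 1)), i'.val = i + n → j'.val = j + n →
      ∀ v, a i' j' v = a i j v := by
    intro n
    induction n with
    | zero =>
      intro i j i' j' hi hj v
      rw [Fin.ext (a := i') (b := i) (by omega), Fin.ext (a := j') (b := j) (by omega)]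
    | succ n ih =>
      intro i j i' j' hi hj v
      have := hXs ⟨i' - 1, by omega⟩ j' (by simp; omega) (by omega) v
      rw [← ih i j ⟨i' - 1, by omega⟩ ⟨j' - 1, by omega⟩ (by simp; omega) (by simp; omega),
        ← this]
      congr
      exact Fin.ext (by simp; omega)
  have hlow : ∀ i j : Fin (2 * r + 1), j < i → ∀ v, a i j v = 0 := by
    intro i j hij v
    rw [toeplitz j ⟨i - j, by omega⟩ ⟨0, by omega⟩ i j (by simp; omega) (by simp)]
    have := hX0 ⟨i - j - 1, by omega⟩ ⟨0, by omega⟩ (by simp; omega) rfl v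
    rw [← this]
    congr
    simp; omega
  have hup : ∀ i j : Fin (2 * r + 1), i < j → ∀ v, a i j v = 0 := by
    intro i j hij v
    -- Only the first `r` weights are known to be identities. A diagonal at distance at most `r` is
    -- killed in the first row, where the source weight has index `j - i - 1 < r`; a farther one in
    -- the last column, where the target weight has index `2 * r - (j - i) < r`.
    by_cases hr : j.val - i.val ≤ r
    · rw [toeplitz i ⟨0, by omega⟩ ⟨j - i, by omega⟩ i j (by simp) (by simp; omega)]
      have := hYf ⟨0, by omega⟩ ⟨j - i - 1, by omega⟩ rfl (by simp; omega) v
      rw [hy _ (by simp; omega)] at this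
      rw [← this]
      simp only [Module.End.one_apply]
      congr
      omega
    · have := hYl ⟨2 * r - (j - i) + 1, by omega⟩ ⟨2 * r, by omega⟩ (by simp) (by simp) v
      rw [hy' _ (by simp; omega)] at this
      rw [← this]
      simp only [Module.End.one_apply]
      exact (toeplitz (2 * r - j) i j _ _ (by simp; omega) (by simp; omega) v).symm
  let ψ : V →ₗ[k] W := LinearMap.proj (0 : Fin (2 * r + 1)) ∘ₗ f ∘ₗ
    LinearMap.single k (fun _ => V) 0
  have hψ : ∀ i v, a i i v = ψ v := fun i v =>
    toeplitz i 0 0 i i (by simp) (by simp) v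
  refine ⟨ψ, fun z i => ?_, fun j hj v => ?_⟩
  · have : LinearMap.proj i ∘ₗ f = ψ ∘ₗ LinearMap.proj i := by
      ext j v
      change a i j v = ψ ((Pi.single j v : Fin (2 * r + 1) → V) i)
      rcases lt_trichotomy i j with hij | rfl | hij
      · rw [hup i j hij, Pi.single_eq_of_ne hij.ne, map_zero]
      · rw [hψ, Pi.single_eq_same]
      · rw [hlow i j hij, Pi.single_eq_of_ne hij.ne', map_zero]
    exact LinearMap.congr_fun this z
  · have := hYs ⟨j + 1, by omega⟩ ⟨j, by omega⟩ (by simp) (by simp; omega) v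
    simpa [hψ] using this

end Encoding

/-! ### Spaces with several operators -/

section OperatorModule

variable {k : Type u} [Field k] {κ : Type*} [Fintype κ] {V W V' : Type u} [AddCommGroup V]
  [Module k V] [AddCommGroup W] [Module k W] [AddCommGroup V'] [Module k V']

/-- The weights of the shift that encode a family of operators. -/
noncomputable def operatorWeights (s : κ → Module.End k V) (j : ℕ) : Module.End k V :=
  -- The first block of weights consists of identities, which forces morphisms to be diagonal; the
  -- second lists the operators. The shift on `2 * card κ + 1` copies uses no further weights.
  if h : Fintype.card κ ≤ j ∧ j < 2 * Fintype.card κ then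
    s ((Fintype.equivFin κ).symm ⟨j - Fintype.card κ, by omega⟩) else 1

lemma operatorWeights_of_lt (s : κ → Module.End k V) {j : ℕ} (h : j < Fintype.card κ) :
    operatorWeights s j = 1 := dif_neg (by omega)

/-- The index is uniform in the space and the operators, so one weight can be compared on both sides
of a morphism. -/
lemma exists_operatorWeights (a : κ) : ∃ j < 2 * Fintype.card κ,
    ∀ {V : Type u} [AddCommGroup V] [Module k V] (s : κ → Module.End k V),
      operatorWeights s j = s a := by
  refine ⟨Fintype.card κ + Fintype.equivFin κ a, by omega, fun s => ?_⟩
  rw [operatorWeights, dif_pos (by omega)]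
  simp

lemma operatorWeights_semiconj {s : κ → Module.End k V} {s' : κ → Module.End k W}
    (ψ : V →ₗ[k] W) (h : ∀ a v, ψ (s a v) = s' a (ψ v)) (j : ℕ) (v : V) :
    ψ (operatorWeights s j v) = operatorWeights s' j (ψ v) := by
  unfold operatorWeights
  split_ifs
  · exact h _ v
  · rfl

/-- The module over the free algebra in two generators that encodes a family of operators. -/
noncomputable def operatorModule [Module.Finite k V] (s : κ → Module.End k V) :
    FinMod k (FreeAlgebra k (Fin 2)) :=
  pairModule (shiftDown k V (2 * Fintype.card κ + 1)) (weightedShift _ (operatorWeights s))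

variable [Module.Finite k V] [Module.Finite k W] [Module.Finite k V']

lemma operatorModule_exists_hom {s : κ → Module.End k V} {s' : κ → Module.End k W}
    (ψ : V →ₗ[k] W) (h : ∀ a v, ψ (s a v) = s' a (ψ v)) :
    ∃ φ : operatorModule s ⟶ operatorModule s',
      pairHomLinear φ = ψ.compLeft (Fin (2 * Fintype.card κ + 1)) := by
  refine ⟨pairHom (ψ.compLeft _) (fun z => ?_) (fun z => ?_), rfl⟩
  · ext i
    by_cases hi : i.val + 1 < 2 * Fintype.card κ + 1
    · simp [shiftDown_apply_of_lt hi]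
    · simp [shiftDown_apply_of_not_lt hi]
  · ext i
    rcases Nat.eq_zero_or_pos i.val with hi | hi
    · simp [weightedShift_apply_of_eq_zero _ hi]
    · simp [weightedShift_apply_of_pos _ hi, operatorWeights_semiconj ψ h]

/-- The morphism between encoded operators that is induced by an intertwining map. -/
noncomputable def operatorModuleHom {s : κ → Module.End k V} {s' : κ → Module.End k W}
    (ψ : V →ₗ[k] W) (h : ∀ a v, ψ (s a v) = s' a (ψ v)) : operatorModule s ⟶ operatorModule s' :=
  (operatorModule_exists_hom ψ h).choose

@[simp]
lemma pairHomLinear_operatorModuleHom {s : κ → Module.End k V} {s' : κ → Module.End k W}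
    (ψ : V →ₗ[k] W) (h : ∀ a v, ψ (s a v) = s' a (ψ v)) :
    pairHomLinear (operatorModuleHom ψ h) = ψ.compLeft (Fin (2 * Fintype.card κ + 1)) :=
  (operatorModule_exists_hom ψ h).choose_spec

lemma operatorModuleHom_surjective {s : κ → Module.End k V} {s' : κ → Module.End k W}
    (φ : operatorModule s ⟶ operatorModule s') : ∃ (ψ : V →ₗ[k] W)
      (h : ∀ a v, ψ (s a v) = s' a (ψ v)), operatorModuleHom ψ h = φ := by
  obtain ⟨ψ, hψ, h⟩ := eq_diagonal_of_commute_shifts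
    (fun j hj => operatorWeights_of_lt s hj) (fun j hj => operatorWeights_of_lt s' hj)
    (pairHomLinear φ) (pairHomLinear_zero_op φ) (pairHomLinear_one_op φ)
  refine ⟨ψ, fun a v => ?_, pairHomLinear_injective ?_⟩
  · obtain ⟨j, hj, e⟩ := exists_operatorWeights (k := k) a
    rw [← e s, ← e s']
    exact h j hj v
  · rw [pairHomLinear_operatorModuleHom]
    refine LinearMap.ext fun z => funext fun i => ?_
    exact (hψ z i).symm

lemma operatorModuleHom_injective {s : κ → Module.End k V} {s' : κ → Module.End k W}
    {ψ ψ' : V →ₗ[k] W} {h : ∀ a v, ψ (s a v) = s' a (ψ v)}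
    {h' : ∀ a v, ψ' (s a v) = s' a (ψ' v)} (e : operatorModuleHom ψ h = operatorModuleHom ψ' h') :
    ψ = ψ' := by
  have := congrArg pairHomLinear e
  rw [pairHomLinear_operatorModuleHom, pairHomLinear_operatorModuleHom] at this
  ext v
  exact congrFun (LinearMap.congr_fun this fun _ => v) 0

end OperatorModule

/-! ### Representations of a generalized Kronecker quiver -/

section Kronecker

variable {k : Type u} [Field k] {ι : Type u} [Fintype ι] {U W U' W' U'' W'' : Type u}
  [AddCommGroup U] [Module k U] [AddCommGroup W] [Module k W]
  [AddCommGroup U'] [Module k U'] [AddCommGroup W'] [Module k W']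
  [AddCommGroup U''] [Module k U''] [AddCommGroup W''] [Module k W'']

/-- The operators on `U × W` that encode a family of maps `U → W`. -/
def kroneckerOperators (x : ι → U →ₗ[k] W) : Option ι → Module.End k (U × W)
  -- The idempotent with image `U`: whatever commutes with it respects the decomposition `U × W`.
  | none => LinearMap.inl k U W ∘ₗ LinearMap.fst k U W
  | some i => LinearMap.inr k U W ∘ₗ x i ∘ₗ LinearMap.fst k U W

lemma sinkHom_comm {ι : Type*} (x : ι → U →ₗ[k] W) (w : W) (i : ι) (u : PUnit.{u + 1}) :
    LinearMap.toSpanSingleton k W w ((0 : PUnit.{u + 1} →ₗ[k] k) u) =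
      x i ((0 : PUnit.{u + 1} →ₗ[k] U) u) := by
  simp

open Classical in
lemma sourceHom_comm (x : ι → U →ₗ[k] W) (u : U) (i : ι) (c : k) :
    Fintype.linearCombination k (fun i => x i u) (LinearMap.single k (fun _ : ι => k) i c) =
      x i (LinearMap.toSpanSingleton k U u c) := by
  rw [LinearMap.single_apply, Fintype.linearCombination_apply_single]
  simp

variable [Module.Finite k U] [Module.Finite k W] [Module.Finite k U'] [Module.Finite k W']
  [Module.Finite k U''] [Module.Finite k W'']

/-- The module over the free algebra in two generators that encodes a family of maps `U → W`. -/
noncomputable def kroneckerModule (x : ι → U →ₗ[k] W) : FinMod k (FreeAlgebra k (Fin 2)) :=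
  operatorModule (kroneckerOperators x)

variable {x : ι → U →ₗ[k] W} {y : ι → U' →ₗ[k] W'} {z : ι → U'' →ₗ[k] W''}

/-- The morphism given by a morphism of representations. -/
noncomputable def kroneckerHom (α : U →ₗ[k] U') (β : W →ₗ[k] W')
    (h : ∀ i u, β (x i u) = y i (α u)) : kroneckerModule x ⟶ kroneckerModule y :=
  operatorModuleHom (LinearMap.prodMap α β) (by
    rintro (_ | i) ⟨u, w⟩
    · simp [kroneckerOperators]
    · simp [kroneckerOperators, h])

lemma kroneckerHom_injective {α α' : U →ₗ[k] U'} {β β' : W →ₗ[k] W'}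
    {h : ∀ i u, β (x i u) = y i (α u)} {h' : ∀ i u, β' (x i u) = y i (α' u)}
    (e : kroneckerHom α β h = kroneckerHom α' β' h') : α = α' ∧ β = β' := by
  have := operatorModuleHom_injective e
  refine ⟨?_, ?_⟩
  · ext u
    simpa using congrArg Prod.fst (LinearMap.congr_fun this (u, 0))
  · ext w
    simpa using congrArg Prod.snd (LinearMap.congr_fun this (0, w))

/-- Compatibility with the idempotent makes `ψ` block diagonal; compatibility with the other
operators says that its blocks intertwine the arrows. -/
lemma kroneckerHom_surjective (φ : kroneckerModule x ⟶ kroneckerModule y) :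
    ∃ (α : U →ₗ[k] U') (β : W →ₗ[k] W') (h : ∀ i u, β (x i u) = y i (α u)),
      kroneckerHom α β h = φ := by
  obtain ⟨ψ, h, rfl⟩ := operatorModuleHom_surjective φ
  have h₁ : ∀ u w, ψ (u, 0) = ((ψ (u, w)).1, 0) := fun u w => by
    simpa [kroneckerOperators] using h none (u, w)
  have h₂ : ∀ i u, ψ (0, x i u) = (0, y i (ψ (u, 0)).1) := fun i u => by
    simpa [kroneckerOperators] using h (some i) (u, 0)
  refine ⟨LinearMap.fst k U' W' ∘ₗ ψ ∘ₗ LinearMap.inl k U W,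
    LinearMap.snd k U' W' ∘ₗ ψ ∘ₗ LinearMap.inr k U W, fun i u => by simp [h₂], ?_⟩
  have : LinearMap.prodMap (LinearMap.fst k U' W' ∘ₗ ψ ∘ₗ LinearMap.inl k U W)
      (LinearMap.snd k U' W' ∘ₗ ψ ∘ₗ LinearMap.inr k U W) = ψ := by
    refine LinearMap.prod_ext ?_ ?_
    · ext u
      · simp
      · have := congrArg Prod.snd (h₁ u 0)
        simp only at this
        simp [this, ← Prod.zero_eq_mk]
    · ext w
      · have := congrArg Prod.fst (h₁ 0 w)
        simp only [← Prod.zero_eq_mk, map_zero, Prod.fst_zero] at this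
        simp [← this, ← Prod.zero_eq_mk]
      · simp
  unfold kroneckerHom
  congr

lemma pairHomLinear_kroneckerHom (α : U →ₗ[k] U') (β : W →ₗ[k] W')
    (h : ∀ i u, β (x i u) = y i (α u)) : pairHomLinear (kroneckerHom α β h) =
      (LinearMap.prodMap α β).compLeft (Fin (2 * Fintype.card (Option ι) + 1)) :=
  pairHomLinear_operatorModuleHom _ _

lemma kroneckerHom_ext {φ ψ : kroneckerModule x ⟶ kroneckerModule y}
    (h : pairHomLinear φ = pairHomLinear ψ) : φ = ψ := pairHomLinear_injective h

lemma kroneckerHom_id : kroneckerHom (x := x) (y := x) LinearMap.id LinearMap.id (fun _ _ => rfl) =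
    𝟙 _ := by
  refine kroneckerHom_ext ?_
  rw [pairHomLinear_kroneckerHom]
  rfl

lemma kroneckerHom_comp (α : U →ₗ[k] U') (β : W →ₗ[k] W') (h : ∀ i u, β (x i u) = y i (α u))
    (α' : U' →ₗ[k] U'') (β' : W' →ₗ[k] W'') (h' : ∀ i u, β' (y i u) = z i (α' u)) :
    kroneckerHom α β h ≫ kroneckerHom α' β' h' =
      kroneckerHom (α' ∘ₗ α) (β' ∘ₗ β) (fun i u => by simp [h, h']) := by
  refine kroneckerHom_ext ?_
  refine (pairHomLinear_comp _ _).trans ?_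
  simp only [pairHomLinear_kroneckerHom]
  rfl

lemma kroneckerHom_add (α α' : U →ₗ[k] U') (β β' : W →ₗ[k] W')
    (h : ∀ i u, β (x i u) = y i (α u)) (h' : ∀ i u, β' (x i u) = y i (α' u)) :
    kroneckerHom (α + α') (β + β') (fun i u => by simp [h, h']) =
      kroneckerHom α β h + kroneckerHom α' β' h' := by
  refine kroneckerHom_ext (Eq.trans ?_ (pairHomLinear_add _ _).symm)
  simp only [pairHomLinear_kroneckerHom]
  rfl

lemma kroneckerHom_smul (c : k) (α : U →ₗ[k] U') (β : W →ₗ[k] W')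
    (h : ∀ i u, β (x i u) = y i (α u)) :
    kroneckerHom (c • α) (c • β) (fun i u => by simp [h]) = c • kroneckerHom α β h := by
  refine kroneckerHom_ext (Eq.trans ?_ (pairHomLinear_smul c _).symm)
  simp only [pairHomLinear_kroneckerHom]
  rfl

lemma kroneckerHom_congr {α α' : U →ₗ[k] U'} {β β' : W →ₗ[k] W'}
    {h : ∀ i u, β (x i u) = y i (α u)} {h' : ∀ i u, β' (x i u) = y i (α' u)} (hα : α = α')
    (hβ : β = β') : kroneckerHom α β h = kroneckerHom α' β' h' := by
  subst hα hβ
  rfl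

variable (k ι) in
/-- The module of the simple projective representation `0 → k`. -/
noncomputable abbrev sinkModule : FinMod k (FreeAlgebra k (Fin 2)) :=
  kroneckerModule (fun _ : ι => (0 : PUnit.{u + 1} →ₗ[k] k))

variable (k ι) in
open Classical in
/-- The module of the projective representation `k → k ^ ι`. -/
noncomputable abbrev sourceModule : FinMod k (FreeAlgebra k (Fin 2)) :=
  kroneckerModule (fun i : ι => LinearMap.single k (fun _ : ι => k) i)

variable (x) in
/-- The morphisms out of the module of the simple projective representation. -/
noncomputable def sinkHom : W →ₗ[k] (sinkModule k ι ⟶ kroneckerModule x) where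
  toFun w := kroneckerHom 0 (LinearMap.toSpanSingleton k W w) (sinkHom_comm x w)
  map_add' w w' := by
    rw [← kroneckerHom_add]
    exact kroneckerHom_congr (by simp) (by ext; simp)
  map_smul' c w := by
    rw [RingHom.id_apply, ← kroneckerHom_smul]
    exact kroneckerHom_congr (by simp) (by ext; simp)

lemma sinkHom_bijective : Function.Bijective (sinkHom x) := by
  refine ⟨fun w w' h => ?_, fun φ => ?_⟩
  · simpa using LinearMap.congr_fun (kroneckerHom_injective (h := sinkHom_comm x w)
      (h' := sinkHom_comm x w') h).2 1
  · obtain ⟨α, β, h, rfl⟩ := kroneckerHom_surjective φ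
    refine ⟨β 1, kroneckerHom_congr (h := sinkHom_comm x _) ?_ (by ext; simp)⟩
    ext u
    rw [Subsingleton.elim u 0, map_zero, map_zero]

variable (x) in
/-- The morphisms out of the module of the projective representation `k → k ^ ι`. -/
noncomputable def sourceHom : U →ₗ[k] (sourceModule k ι ⟶ kroneckerModule x) where
  toFun u := kroneckerHom (LinearMap.toSpanSingleton k U u)
    (Fintype.linearCombination k fun i => x i u) (sourceHom_comm x u)
  map_add' w w' := by
    classical
    rw [← kroneckerHom_add]
    refine kroneckerHom_congr (by ext; simp) (LinearMap.pi_ext' fun i => ?_)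
    ext
    simp [Fintype.linearCombination_apply_single]
  map_smul' c w := by
    classical
    rw [RingHom.id_apply, ← kroneckerHom_smul]
    refine kroneckerHom_congr (by ext; simp) (LinearMap.pi_ext' fun i => ?_)
    ext
    simp [Fintype.linearCombination_apply_single]

/-- Yoneda at the source vertex: the image `u` of `1` is free, and the arrows then force the basis
vector `i` of `k ^ ι` to go to `x i u`. -/
lemma sourceHom_bijective : Function.Bijective (sourceHom x) := by
  classical
  refine ⟨fun w w' h => ?_, fun φ => ?_⟩
  · simpa using LinearMap.congr_fun (kroneckerHom_injective (h := sourceHom_comm x w)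
      (h' := sourceHom_comm x w') h).1 1
  · obtain ⟨α, β, h, rfl⟩ := kroneckerHom_surjective φ
    refine ⟨α 1, kroneckerHom_congr (h := sourceHom_comm x _) (by ext; simp)
      (LinearMap.pi_ext' fun i => ?_)⟩
    ext
    have := h i 1
    rw [LinearMap.single_apply] at this
    rw [LinearMap.comp_apply, LinearMap.comp_apply, LinearMap.single_apply,
      Fintype.linearCombination_apply_single, one_smul, ← this]

lemma sinkHom_comp (w : W) (α : U →ₗ[k] U') (β : W →ₗ[k] W') (h : ∀ i u, β (x i u) = y i (α u)) :
    sinkHom x w ≫ kroneckerHom α β h = sinkHom y (β w) :=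
  (kroneckerHom_comp _ _ (sinkHom_comm x w) ..).trans
    (kroneckerHom_congr (h' := sinkHom_comm y _) (by simp) (by ext; simp))

lemma sourceHom_comp (u : U) (α : U →ₗ[k] U') (β : W →ₗ[k] W')
    (h : ∀ i u, β (x i u) = y i (α u)) :
    sourceHom x u ≫ kroneckerHom α β h = sourceHom y (α u) := by
  classical
  refine (kroneckerHom_comp _ _ (sourceHom_comm x u) ..).trans
    (kroneckerHom_congr (h' := sourceHom_comm y _) (by ext; simp) (LinearMap.pi_ext' fun i => ?_))
  ext
  simp [Fintype.linearCombination_apply_single, h]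

variable (k) in
open Classical in
/-- The morphism of the arrow `i` between the projective representations. -/
noncomputable def sinkToSource (i : ι) : sinkModule k ι ⟶ sourceModule k ι :=
  sinkHom _ (Pi.single i 1)

lemma sinkToSource_comp (i : ι) (u : U) :
    sinkToSource k i ≫ sourceHom x u = sinkHom x (x i u) := by
  classical
  refine (sinkHom_comp _ _ _ (sourceHom_comm x u)).trans ?_
  rw [Fintype.linearCombination_apply_single, one_smul]

end Kronecker

/-! ### Directed unions -/

section DirectedUnion

variable {k : Type u} [Field k] {N : Type u} [AddCommGroup N] [Module k N]

/-- The map from the colimit to `N` is injective because each stage embeds, and surjective because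
the stages cover `N`. -/
lemma exists_equiv_of_directed_union {J : Type u} [Preorder J] [IsDirectedOrder J] [Nonempty J]
    (P : J → Submodule k N) (hP : Monotone P) (hN : ∀ v, ∃ j, v ∈ P j) {H : J ⥤ ModuleCat.{u} k}
    {c : Cocone H} (hc : IsColimit c) (α : ∀ j, P j ≃ₗ[k] H.obj j)
    (hα : ∀ (i j : J) (f : i ⟶ j) (v : P i),
      H.map f (α i v) = α j (Submodule.inclusion (hP (leOfHom f)) v)) :
    ∃ e : c.pt ≃ₗ[k] N, ∀ j (v : P j), e (c.ι.app j (α j v)) = v := by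
  let s : Cocone H :=
    { pt := ModuleCat.of k N
      ι :=
        { app := fun j => ModuleCat.ofHom ((P j).subtype ∘ₗ (α j).symm.toLinearMap)
          naturality := fun i j f => by
            ext v
            obtain ⟨v, rfl⟩ := (α i).surjective v
            simp [hα] } }
  have hs : ∀ j (v : P j), (hc.desc s).hom (c.ι.app j (α j v)) = v := fun j v => by
    have := congrArg (fun f => f (α j v)) (hc.fac s j)
    exact this.trans (by simp [s])
  refine ⟨LinearEquiv.ofBijective (hc.desc s).hom
    ⟨(injective_iff_map_eq_zero _).2 fun x hx => ?_, fun v => ?_⟩, hs⟩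
  · obtain ⟨j, y, rfl⟩ := Concrete.isColimit_exists_rep H hc x
    obtain ⟨v, rfl⟩ := (α j).surjective y
    have : v = 0 := Subtype.ext ((hs j v).symm.trans hx)
    rw [this, map_zero, map_zero]
  · obtain ⟨j, hj⟩ := hN v
    exact ⟨_, hs j ⟨v, hj⟩⟩

end DirectedUnion

/-! ### The diagram of finite-dimensional subrepresentations -/

section Diagram

variable {k : Type u} [Field k] {N : Type u} [AddCommGroup N] [Module k N] {ι : Type u}
  (x : ι → Module.End k N)

/-- The finite-dimensional subrepresentations of the representation `N ⇉ N` given by `x`. -/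
def FinSubrep : Type u :=
  {p : Submodule k N × Submodule k N //
    (Module.Finite k p.1 ∧ Module.Finite k p.2) ∧ ∀ i, p.1 ≤ p.2.comap (x i)}

namespace FinSubrep

variable {x}

instance : PartialOrder (FinSubrep x) := inferInstanceAs (PartialOrder (Subtype _))

/-- The subspace at the source. -/
def source (p : FinSubrep x) : Submodule k N := p.1.1

/-- The subspace at the target. -/
def target (p : FinSubrep x) : Submodule k N := p.1.2

instance (p : FinSubrep x) : Module.Finite k p.source := p.2.1.1

instance (p : FinSubrep x) : Module.Finite k p.target := p.2.1.2

lemma source_mono : Monotone (source (x := x)) := fun _ _ h => h.1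

lemma target_mono : Monotone (target (x := x)) := fun _ _ h => h.2

instance : Nonempty (FinSubrep x) := ⟨⟨(⊥, ⊥), ⟨inferInstance, inferInstance⟩, fun _ => bot_le⟩⟩

instance : IsDirectedOrder (FinSubrep x) where
  directed p q := by
    have := p.2.1.1
    have := p.2.1.2
    have := q.2.1.1
    have := q.2.1.2
    exact ⟨⟨(p.1.1 ⊔ q.1.1, p.1.2 ⊔ q.1.2), ⟨inferInstance, inferInstance⟩, fun i =>
      sup_le ((p.2.2 i).trans (Submodule.comap_mono le_sup_left))
        ((q.2.2 i).trans (Submodule.comap_mono le_sup_right))⟩,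
      ⟨le_sup_left, le_sup_left⟩, ⟨le_sup_right, le_sup_right⟩⟩

/-- Since there are finitely many arrows, the images of one vector span a finite-dimensional target.
-/
lemma exists_mem_source [Finite ι] (v : N) : ∃ p : FinSubrep x, v ∈ p.source :=
  ⟨⟨(Submodule.span k {v}, Submodule.span k (Set.range fun i => x i v)),
    ⟨inferInstance, Module.Finite.span_of_finite k (Set.finite_range _)⟩, fun i =>
      (Submodule.span_singleton_le_iff_mem _ _).2 (Submodule.subset_span ⟨i, rfl⟩)⟩,
    Submodule.mem_span_singleton_self v⟩

lemma exists_mem_target (v : N) : ∃ p : FinSubrep x, v ∈ p.target :=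
  ⟨⟨(⊥, Submodule.span k {v}), ⟨inferInstance, inferInstance⟩, fun _ => bot_le⟩,
    Submodule.mem_span_singleton_self v⟩

/-- The structure maps of a subrepresentation. -/
def maps (p : FinSubrep x) (i : ι) : p.source →ₗ[k] p.target := (x i).restrict (p.2.2 i)

lemma inclusion_maps {p q : FinSubrep x} (h : p ≤ q) (i : ι) (u : p.source) :
    Submodule.inclusion (target_mono h) (p.maps i u) =
      q.maps i (Submodule.inclusion (source_mono h) u) := rfl

variable [Fintype ι]

/-- The morphism between the encoded representations given by an inclusion. -/
noncomputable def kroneckerInclusion {p q : FinSubrep x} (h : p ≤ q) :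
    kroneckerModule p.maps ⟶ kroneckerModule q.maps :=
  kroneckerHom (Submodule.inclusion (source_mono h)) (Submodule.inclusion (target_mono h))
    (inclusion_maps h)

lemma kroneckerInclusion_comp {p q r : FinSubrep x} (h : p ≤ q) (h' : q ≤ r) :
    kroneckerInclusion h ≫ kroneckerInclusion h' = kroneckerInclusion (h.trans h') :=
  (kroneckerHom_comp _ _ (inclusion_maps h) _ _ (inclusion_maps h')).trans
    (kroneckerHom_congr rfl rfl)

lemma kroneckerInclusion_refl (p : FinSubrep x) : kroneckerInclusion (le_refl p) = 𝟙 _ :=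
  (kroneckerHom_congr rfl rfl).trans kroneckerHom_id

variable (x) in
/-- The diagram of modules over the free algebra in two generators that encodes the
finite-dimensional subrepresentations. -/
noncomputable def diagram : FinSubrep x ⥤ FinMod k (FreeAlgebra k (Fin 2)) where
  obj p := kroneckerModule p.maps
  map f := kroneckerInclusion (leOfHom f)
  map_id p := kroneckerInclusion_refl p
  map_comp f g := (kroneckerInclusion_comp (leOfHom f) (leOfHom g)).symm

end FinSubrep

variable [Fintype ι]

/-- Functors that are represented on finite-dimensional representations by the indecomposable
projectives take the value `N`, with the operators `x`, at a filtered colimit. -/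
lemma exists_obj_with_operators {C : Type (u + 1)} [Category.{u} C]
    [HasFilteredColimitsOfSize.{u, u} C] (G : FinMod k (FreeAlgebra k (Fin 2)) ⥤ C)
    {V₂ V₁ : C ⥤ ModuleCat.{u} k} [PreservesFilteredColimitsOfSize.{u, u} V₂]
    [PreservesFilteredColimitsOfSize.{u, u} V₁] (τ : ι → (V₂ ⟶ V₁))
    (e₂ : ∀ Z, (sourceModule k ι ⟶ Z) ≃ₗ[k] V₂.obj (G.obj Z))
    (e₁ : ∀ Z, (sinkModule k ι ⟶ Z) ≃ₗ[k] V₁.obj (G.obj Z))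
    (he₂ : ∀ {Z Z'} (f : Z ⟶ Z') φ, V₂.map (G.map f) (e₂ Z φ) = e₂ Z' (φ ≫ f))
    (he₁ : ∀ {Z Z'} (f : Z ⟶ Z') φ, V₁.map (G.map f) (e₁ Z φ) = e₁ Z' (φ ≫ f))
    (hτ : ∀ i {Z} φ, (τ i).app (G.obj Z) (e₂ Z φ) = e₁ Z (sinkToSource k i ≫ φ)) :
    ∃ (M : C) (a₂ : V₂.obj M ≃ₗ[k] N) (a₁ : V₁.obj M ≃ₗ[k] N),
      ∀ i v, a₁ ((τ i).app M v) = x i (a₂ v) := by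
  let K := FinSubrep.diagram x ⋙ G
  let c := colimit.cocone K
  have hc : IsColimit c := colimit.isColimit K
  let α₂ (p : FinSubrep x) : p.source ≃ₗ[k] V₂.obj (K.obj p) :=
    (LinearEquiv.ofBijective (sourceHom p.maps) sourceHom_bijective).trans
      (e₂ (kroneckerModule p.maps))
  let α₁ (p : FinSubrep x) : p.target ≃ₗ[k] V₁.obj (K.obj p) :=
    (LinearEquiv.ofBijective (sinkHom p.maps) sinkHom_bijective).trans
      (e₁ (kroneckerModule p.maps))
  obtain ⟨a₂, h₂⟩ := exists_equiv_of_directed_union FinSubrep.source FinSubrep.source_mono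
    FinSubrep.exists_mem_source (isColimitOfPreserves V₂ hc) α₂ fun p q f v =>
      (he₂ _ _).trans (congrArg (e₂ _) (sourceHom_comp _ _ _
        (FinSubrep.inclusion_maps (leOfHom f))))
  obtain ⟨a₁, h₁⟩ := exists_equiv_of_directed_union FinSubrep.target FinSubrep.target_mono
    FinSubrep.exists_mem_target (isColimitOfPreserves V₁ hc) α₁ fun p q f v =>
      (he₁ _ _).trans (congrArg (e₁ _) (sinkHom_comp _ _ _
        (FinSubrep.inclusion_maps (leOfHom f))))
  refine ⟨c.pt, a₂, a₁, fun i v => ?_⟩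
  -- Compatibility with the arrows can be checked on a stage, where it is `sinkToSource_comp`.
  obtain ⟨p, y, rfl⟩ := Concrete.isColimit_exists_rep _ (isColimitOfPreserves V₂ hc) v
  obtain ⟨u, rfl⟩ := (α₂ p).surjective y
  have key : (τ i).app (K.obj p) (α₂ p u) = α₁ p (p.maps i u) :=
    (hτ i _).trans (congrArg (e₁ _) (sinkToSource_comp ..))
  have nat : (τ i).app c.pt (V₂.map (c.ι.app p) (α₂ p u)) =
      V₁.map (c.ι.app p) ((τ i).app (K.obj p) (α₂ p u)) :=
    NatTrans.naturality_apply (τ i) (c.ι.app p) (α₂ p u)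
  refine (congrArg a₁ (nat.trans (congrArg _ key))).trans ((h₁ p _).trans ?_)
  exact (congrArg (x i) (h₂ p u)).symm

end Diagram

/-! ### Approximations -/

section Approximation

variable {k R : Type u} [Field k] [Ring R] [Algebra k R]

open scoped ModuleCat in
-- Finitely presented modules over a finite-dimensional algebra are finite-dimensional. This is what
-- makes left `add(C)`-approximations exist.
lemma finite_hom_of_finitePresentation [Module.Finite k R] (B C : FpMod R) :
    Module.Finite k (B.obj ⟶ C.obj) := by
  have : Module.Finite k Rᵐᵒᵖ := Module.Finite.equiv (MulOpposite.opLinearEquiv k)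
  have := B.property.1
  have hB : Module.FinitePresentation Rᵐᵒᵖ B.obj := B.property
  have hC : Module.FinitePresentation Rᵐᵒᵖ C.obj := C.property
  have : Module.Finite k B.obj := Module.Finite.trans Rᵐᵒᵖ B.obj
  have : Module.Finite k C.obj := Module.Finite.trans Rᵐᵒᵖ C.obj
  let e : (B.obj ⟶ C.obj) →ₗ[k] (B.obj →ₗ[k] C.obj) :=
    { toFun := fun f => f.hom.restrictScalars k
      map_add' := fun _ _ => rfl
      map_smul' := fun _ _ => rfl }
  refine Module.Finite.of_injective e fun f g h => ?_
  ext b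
  exact LinearMap.congr_fun h b

variable (k) in
/-- Left approximations by `add(C)`. -/
lemma exists_left_approximation [Module.Finite k R] (C B : FpMod R) :
    ∃ (L : FpMod R) (g : B ⟶ L), addClosure C L ∧
      ∀ Z, addClosure C Z → ∀ f : B ⟶ Z, ∃ l : L ⟶ Z, g ≫ l = f := by
  have := finite_hom_of_finitePresentation (k := k) B C
  have hC : Module.FinitePresentation Rᵐᵒᵖ C.obj := C.property
  -- The components of the approximation `B ⟶ C ^ m` span `Hom(B, C)`, so every map to `C` is a
  -- linear combination of them.
  obtain ⟨m, φ, hφ⟩ := Module.Finite.exists_fin (R := k) (M := B.obj ⟶ C.obj)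
  let L : FpMod R := ⟨ModuleCat.of Rᵐᵒᵖ (Fin m → C.obj),
    inferInstanceAs (Module.FinitePresentation Rᵐᵒᵖ (Fin m → C.obj))⟩
  let p (i : Fin m) : L.obj ⟶ C.obj := ModuleCat.ofHom (LinearMap.proj i)
  let g : B.obj ⟶ L.obj := ModuleCat.ofHom (LinearMap.pi fun i => (φ i).hom)
  have hg : ∀ i, g ≫ p i = φ i := fun i => rfl
  have ext₁ : ∀ f : B.obj ⟶ C.obj, ∃ l : L.obj ⟶ C.obj, g ≫ l = f := fun f => by
    obtain ⟨a, rfl⟩ := (Submodule.mem_span_range_iff_exists_fun k).1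
      (hφ ▸ Submodule.mem_top : f ∈ Submodule.span k (Set.range φ))
    refine ⟨∑ i, a i • p i, ?_⟩
    rw [Preadditive.comp_sum]
    exact Finset.sum_congr rfl fun i _ => by rw [Linear.comp_smul, hg]
  refine ⟨L, ObjectProperty.homMk g, ⟨m, ⟨Retract.refl _⟩⟩, ?_⟩
  rintro Z ⟨n, ⟨r⟩⟩ f
  choose l hl using fun j : Fin n =>
    ext₁ (f.hom ≫ r.i ≫ ModuleCat.ofHom (LinearMap.proj (φ := fun _ => C.obj) j))
  refine ⟨ObjectProperty.homMk (ModuleCat.ofHom (LinearMap.pi fun j => (l j).hom) ≫ r.r), ?_⟩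
  have : g ≫ ModuleCat.ofHom (LinearMap.pi fun j => (l j).hom) = f.hom ≫ r.i := by
    ext b j
    exact congrArg (fun q => q.hom b) (hl j)
  ext1
  change g ≫ ModuleCat.ofHom _ ≫ r.r = f.hom
  rw [reassoc_of% this, r.retract, Category.comp_id]

/-- For a controlled functor, the morphisms out of `F Q` modulo `add(C)` are the morphisms out
of `Q`. -/
noncomputable def controlledEquiv {A : Type u} [Ring A] [Algebra k A] (F : FinMod k A ⥤ FpMod R)
    [F.Additive] [F.Linear k] [F.Faithful] {C : FpMod R}
    (hsum : ∀ {M N : FinMod k A} (f : F.obj M ⟶ F.obj N), ∃ (g : M ⟶ N) (h : F.obj M ⟶ F.obj N),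
      FactorsThroughProperty (addClosure C) h ∧ f = F.map g + h)
    (hinter : ∀ {M N : FinMod k A} (g : M ⟶ N),
      FactorsThroughProperty (addClosure C) (F.map g) → F.map g = 0)
    {Q : FinMod k A} {L : FpMod R} (g : F.obj Q ⟶ L) (hL : addClosure C L)
    (hg : ∀ Z, addClosure C Z → ∀ f : F.obj Q ⟶ Z, ∃ l : L ⟶ Z, g ≫ l = f) (Z : FinMod k A) :
    (Q ⟶ Z) ≃ₗ[k] (homQuotient k g.hom).obj (F.obj Z).obj :=
  LinearEquiv.ofBijective
    { toFun := fun φ => homClass g.hom (F.map φ).hom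
      map_add' := fun φ ψ => by
        rw [F.map_add, ← map_add]
        rfl
      map_smul' := fun c φ => by
        rw [F.map_smul, RingHom.id_apply, ← map_smul]
        rfl }
    ⟨(injective_iff_map_eq_zero _).2 fun φ hφ => by
      -- A factorization of `F φ` through `g` is one through `add(C)`, so `F φ = 0` by the trivial
      -- intersection, and faithfulness gives `φ = 0`.
      obtain ⟨l, hl⟩ := homClass_eq_zero.1 hφ
      exact F.map_injective ((hinter φ ⟨L, hL, g, ObjectProperty.homMk l,
        ObjectProperty.hom_ext _ hl.symm⟩).trans (F.map_zero _ _).symm),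
    fun x => by
      obtain ⟨f, rfl⟩ := homClass_surjective g.hom x
      -- Modulo `add(C)` every `f` is some `F φ`, and the error term factors through the
      -- approximation `g`.
      obtain ⟨φ, _, ⟨Y, hY, a, b, rfl⟩, hf⟩ := hsum (ObjectProperty.homMk f)
      obtain ⟨l, rfl⟩ := hg Y hY a
      refine ⟨φ, (homClass_eq_iff.2 ⟨l.hom ≫ b.hom, ?_⟩).symm⟩
      rw [eq_sub_iff_add_eq']
      exact (congrArg InducedCategory.Hom.hom hf).symm.trans (by simp)⟩

end Approximation

/-! ### Construction of the definable subcategory and the interpretation functor. -/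

theorem corollary4p5 (k R : Type u) [Field k] [Ring R] [Algebra k R] [Module.Finite k R]
    (hR : IsFinitelyControlledWild k R)
    (S : Type u) [Ring S] [Algebra k S] [Algebra.FiniteType k S] :
    ∃ D : ObjectProperty (RightMod R), IsDefinableSubcategory D ∧
      ∃ I : D.FullSubcategory ⥤ RightMod S, IsInterpretationFunctor k I ∧ I.EssSurj := by
  obtain ⟨F, hF⟩ := hR
  obtain ⟨C, hC⟩ := hF.controlled
  have := hF.additive
  have := hF.linear
  have := hF.faithful
  obtain ⟨ι, _, f, hf⟩ := Algebra.FiniteType.iff_quotient_freeAlgebra'.1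
    (inferInstance : Algebra.FiniteType k S)
  -- Right `S`-modules are modules over `Sᵐᵒᵖ`; reversal of words identifies the free algebra with
  -- its opposite and so presents `Sᵐᵒᵖ`.
  let π : FreeAlgebra k ι →ₐ[k] Sᵐᵒᵖ := (AlgHom.op f).comp FreeAlgebra.starHom.toAlgHom
  have hπ : Function.Surjective π := fun s => by
    obtain ⟨p, hp⟩ := hf s.unop
    obtain ⟨q, hq⟩ := (FreeAlgebra.starHom (R := k) (X := ι)).surjective (MulOpposite.op p)
    refine ⟨q, ?_⟩
    change AlgHom.op f (FreeAlgebra.starHom q) = s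
    rw [hq]
    exact MulOpposite.unop_injective hp
  obtain ⟨L₁, g₁, hL₁, hg₁⟩ := exists_left_approximation k C (F.obj (sinkModule k (Option ι)))
  obtain ⟨L₂, g₂, hL₂, hg₂⟩ := exists_left_approximation k C (F.obj (sourceModule k (Option ι)))
  -- As `L₂` lies in `add(C)`, the arrows extend to the approximations and hence act on the
  -- quotients.
  choose γ hγ using fun i : Option ι => hg₁ L₂ hL₂ (F.map (sinkToSource k i) ≫ g₂)
  have hγ' : ∀ i, g₁.hom ≫ (γ i).hom = (F.map (sinkToSource k i)).hom ≫ g₂.hom := fun i =>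
    congrArg InducedCategory.Hom.hom (hγ i)
  let τ (i : Option ι) : homQuotient k g₂.hom ⟶ homQuotient k g₁.hom :=
    homQuotientPrecomp (F.map (sinkToSource k i)).hom (γ i).hom (hγ' i)
  have fp : ∀ X : FpMod R, Module.FinitePresentation Rᵐᵒᵖ X.obj := fun X => X.property
  have : ∀ X : FpMod R, IsFinitelyPresentable.{u} X.obj := fun X =>
    isFinitelyPresentable_of_finitePresentation X.obj
  have := homQuotient_preservesFilteredColimits (k := k) g₁.hom
  have := homQuotient_preservesFilteredColimits (k := k) g₂.hom
  have := fun J : Type u => homQuotient_preservesProducts (k := k) g₁.hom J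
  have := fun J : Type u => homQuotient_preservesProducts (k := k) g₂.hom J
  refine ⟨operatorObjects τ π, ⟨inferInstance, fun J => operatorObjects_closedUnderLimits τ π _,
    fun J _ _ => operatorObjects_closedUnderFilteredColimits τ π J, fun M N hN hM =>
      operatorObjects_closedUnderPure _ _ hγ' π hN hM⟩, operatorFunctor hπ,
    ⟨operatorFunctor_additive hπ, operatorFunctor_linear hπ,
      fun J => operatorFunctor_preservesLimitsOfShape hπ _,
      operatorFunctor_preservesFilteredColimits hπ⟩, ⟨fun N => ?_⟩⟩
  let _ : Module k N := ModuleCat.moduleOfAlgebraModule N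
  have : IsScalarTower k Sᵐᵒᵖ N := ModuleCat.isScalarTower_of_algebra_moduleCat N
  let x : Option ι → Module.End k N
    -- The extra arrow identifies the two copies of `N`; this makes `τ none` invertible at the
    -- colimit.
    | none => 1
    | some i => Algebra.lsmul k k N (π (FreeAlgebra.ι k i))
  obtain ⟨M, a₂, a₁, h⟩ := exists_obj_with_operators x (F ⋙ (finPresModules R).ι) τ
    (controlledEquiv F (fun f => (hC _ _).1 f) (fun g => (hC _ _).2.1 g) g₂ hL₂ hg₂)
    (controlledEquiv F (fun f => (hC _ _).1 f) (fun g => (hC _ _).2.1 g) g₁ hL₁ hg₁)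
    (fun f φ => congrArg (homClass g₂.hom) (congrArg InducedCategory.Hom.hom (F.map_comp φ f)).symm)
    (fun f φ => congrArg (homClass g₁.hom) (congrArg InducedCategory.Hom.hom (F.map_comp φ f)).symm)
    (fun i _ φ => congrArg (homClass g₁.hom)
      (congrArg InducedCategory.Hom.hom (F.map_comp (sinkToSource k i) φ)).symm)
  obtain ⟨hM, e⟩ := exists_operatorFunctor_iso hπ N M a₂ a₁ (h none) fun i => h (some i)
  exact ⟨⟨M, hM⟩, e⟩
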